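/- Fix a horizon $T\in\mathbb N$, a number $M$ of agents and a number $m$ of traded commodities ($m=1$ is the scalar case). Agent $i\in\{1,\dots,M\}$ has state $X_i(t)\in\mathbb R^{n_i}$ and consumption $U_i(t)\in\mathbb R^m$ (negative entries mean generation), with $$X_i(t+1)=A_iX_i(t)+B_iU_i(t)+N_i(t),$$ where $X_i(0)\sim N(0,\Sigma_{i,0})$ and $N_i(t)\sim N(0,P_{i,t})$ ($1\le i\le M$, $0\le t\le T-1$) are all mutually independent and $\Sigma_{i,0},P_{i,t}$ are positive semidefinite. Let $Q_i$ be symmetric positive semidefinite and $R_i$ symmetric positive definite. Let $\mathcal F_t$ be the $\sigma$-algebra generated by all $X_i(0)$ and all $N_i(r)$ with $0\le r<t$, $1\le i\le M$. The LQG ISO problem is to maximize the social welfare $$W(U)=-\,\mathbb E\sum_{t=0}^{T-1}\sum_{i=1}^M\big[X_i(t)^\top Q_iX_i(t)+U_i(t)^\top R_iU_i(t)\big]\in[-\infty,0]$$ over all centralized control laws, i.e. all $U=(U_1,\dots,U_M)$ such that $U(t)$ is $\mathcal F_t$-measurable and $\sum_{i=1}^MU_i(t)=0$ almost surely for $0\le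 t\le T-1$. Let $\alpha^k>0$ with $\lim_k\alpha^k=0$ and $\sum_{k=0}^\infty\alpha^k=\infty$. The bid-price iteration scheme is the following. At each time $s=0,1,\dots,T-1$, start from arbitrary prices $\lambda^0_s(t)\in\mathbb R^m$, $s\le t\le T-1$. For $k=0,1,2,\dots$, each agent $i$ bids an optimal open-loop input sequence $(u^k_{i,s}(t))_{s\le t\le T-1}$ of the deterministic LQR problem $$\min\ \sum_{t=s}^{T-1}\big[x_i(t)^\top Q_ix_i(t)+u_i(t)^\top R_iu_i(t)+\lambda^k_s(t)^\top u_i(t)\big]\quad\text{s.t. } x_i(t+1)=A_ix_i(t)+B_iu_i(t),\ \ x_i(s)=X_i(s),$$ and then the prices are updated by $\lambda^{k+1}_s(t)=\lambda^k_s(t)+\alpha^k\sum_{i=1}^Mu^k_{i,s}(t)$, $s\le t\le T-1$. Agent $i$ implements $U_i(s)=u^\star_{i,s}(s)$, where $u^\star_{i,s}=\lim_{k\to\infty}u^k_{i,s}$; the states then move to time $s+1$ and the iteration is repeated there. Then the scheme is well defined and achieves the optimal social welfare. That is, for every choice of the initial prices the scheme can be carried out, and for every run of it: at every time $s$ and in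 every state of the world, the prices $\lambda^k_s(t)$ and the bids $u^k_{i,s}(t)$ converge as $k\to\infty$ for all $s\le t\le T-1$, and the limiting bids satisfy $\sum_{i=1}^Mu^\star_{i,s}(t)=0$; the total cost incurred is integrable; and the resulting $U$ is a centralized control law that attains the maximum of $W$ over all centralized control laws. -/

import Mathlib

open MeasureTheory ProbabilityTheory Filter
open scoped Topology Matrix ENNReal

/-- A linear-quadratic agent trading `m` commodities (`m = 1` is the scalar case): a state in
`ℝ^dim`, dynamics `x(t+1) = A x(t) + B u(t) (+ noise)`, and one-step cost `xᵀ Q x + uᵀ R u`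
with `Q` positive semidefinite and `R` positive definite. -/
structure LQAgent (m : ℕ) where
  dim : ℕ
  A : Matrix (Fin dim) (Fin dim) ℝ
  B : Matrix (Fin dim) (Fin m) ℝ
  Q : Matrix (Fin dim) (Fin dim) ℝ
  R : Matrix (Fin m) (Fin m) ℝ
  Q_posSemidef : Q.PosSemidef
  R_posDef : R.PosDef

/-- The state space of an agent. -/
abbrev LQAgent.State {m : ℕ} (a : LQAgent m) : Type := Fin a.dim → ℝ

/-- The one-step cost `xᵀ Q x + uᵀ R u`. -/
def LQAgent.stageCost {m : ℕ} (a : LQAgent m) (x : a.State) (u : Fin m → ℝ) : ℝ :=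
  x ⬝ᵥ (a.Q *ᵥ x) + u ⬝ᵥ (a.R *ᵥ u)

/-- `x` is the noise-free state trajectory on the times `s, …, T`, started at `x(s) = x₀` and
driven by the inputs `u(s), …, u(T-1)`. -/
def LQAgent.IsPlan {m : ℕ} (a : LQAgent m) (s T : ℕ) (x₀ : a.State)
    (x : ℕ → a.State) (u : ℕ → Fin m → ℝ) : Prop :=
  x s = x₀ ∧ ∀ t, s ≤ t → t < T → x (t + 1) = a.A *ᵥ x t + a.B *ᵥ u t

/-- The price-augmented cost `∑_{t=s}^{T-1} (xᵀ Q x + uᵀ R u + λ(t)ᵀ u(t))`. -/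
def LQAgent.pricedCost {m : ℕ} (a : LQAgent m) (s T : ℕ) (price : ℕ → Fin m → ℝ)
    (x : ℕ → a.State) (u : ℕ → Fin m → ℝ) : ℝ :=
  ∑ t ∈ Finset.Ico s T, (a.stageCost (x t) (u t) + price t ⬝ᵥ u t)

/-- `u` is an optimal open-loop input sequence of the deterministic LQR problem with the
price-augmented cost over the times `s, …, T-1`, started at `x₀`. Only the entries
`u(s), …, u(T-1)` and `price(s), …, price(T-1)` matter. -/
def LQAgent.IsOptimalBid {m : ℕ} (a : LQAgent m) (s T : ℕ) (x₀ : a.State)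
    (price : ℕ → Fin m → ℝ) (u : ℕ → Fin m → ℝ) : Prop :=
  ∃ x, a.IsPlan s T x₀ x u ∧
    ∀ x' u', a.IsPlan s T x₀ x' u' → a.pricedCost s T price x u ≤ a.pricedCost s T price x' u'

/-- The bid-price iteration at time `s` from the agents' states `x₀`. In round `k` agent `i`
answers the price vector `price k` by an optimal bid `bid k i`, and then the prices are moved by
`α k` times the excess demand. The initial price vector `price 0` is arbitrary. -/
def IsBidPriceIteration {M m : ℕ} (agents : Fin M → LQAgent m) (T : ℕ) (α : ℕ → ℝ) (s : ℕ)
    (x₀ : ∀ i, (agents i).State) (price : ℕ → ℕ → Fin m → ℝ)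
    (bid : ℕ → Fin M → ℕ → Fin m → ℝ) : Prop :=
  (∀ k i, (agents i).IsOptimalBid s T (x₀ i) (price k) (bid k i)) ∧
    ∀ k t, s ≤ t → t < T → price (k + 1) t = price k t + α k • ∑ i, bid k i t

/-- The closed-loop state `X(0) = X₀`, `X(t+1) = A X(t) + B U(t) + N(t)` of an agent. -/
def LQAgent.closedLoopState {m : ℕ} (a : LQAgent m) {Ω : Type*} (X₀ : Ω → a.State)
    (N : ℕ → Ω → a.State) (U : ℕ → Ω → Fin m → ℝ) : ℕ → Ω → a.State
  | 0 => X₀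
  | t + 1 => fun ω => a.A *ᵥ a.closedLoopState X₀ N U t ω + a.B *ᵥ U t ω + N t ω

/-- The receding-horizon scheme. At each time `s < T` the bid-price iteration is run (afresh, in
each state of the world `ω`) from the current states `X_i(s)`, and agent `i` implements as `U_i(s)`
the time-`s` entry of the limit of its bids. The existence of that limit is not assumed: if the
bids had no limit, `U_i(s)` would be unrestricted. -/
structure IsBidPriceScheme {M m : ℕ} (agents : Fin M → LQAgent m) (T : ℕ) (α : ℕ → ℝ)
    {Ω : Type*} (X₀ : ∀ i, Ω → (agents i).State) (N : ∀ i, ℕ → Ω → (agents i).State)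
    (price : ℕ → ℕ → Ω → ℕ → Fin m → ℝ) (bid : ℕ → ℕ → Fin M → Ω → ℕ → Fin m → ℝ)
    (U : Fin M → ℕ → Ω → Fin m → ℝ) : Prop where
  iteration : ∀ s < T, ∀ ω, IsBidPriceIteration agents T α s
    (fun i => (agents i).closedLoopState (X₀ i) (N i) (U i) s ω)
    (fun k => price s k ω) (fun k i => bid s k i ω)
  implement : ∀ s < T, ∀ ω i l,
    Tendsto (fun k => bid s k i ω s) atTop (𝓝 l) → U i s ω = l

/-- The centralized information at time `t`: the σ-algebra generated by all the initial states and
by all the noises that have entered the states `X(0), …, X(t)`, namely `N_i(r)` with `r < t`. -/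
def centralInformation {M m : ℕ} (agents : Fin M → LQAgent m) {Ω : Type*}
    (X₀ : ∀ i, Ω → (agents i).State) (N : ∀ i, ℕ → Ω → (agents i).State) (t : ℕ) :
    MeasurableSpace Ω :=
  (⨆ i, MeasurableSpace.comap (X₀ i) inferInstance) ⊔
    ⨆ i, ⨆ r, ⨆ (_ : r < t), MeasurableSpace.comap (N i r) inferInstance

/-- The centralized control laws: all inputs at time `t` may depend on the whole centralized
information, and the commodities are balanced at each time `t < T`, almost surely. -/
def centralizedPolicies {M m : ℕ} (agents : Fin M → LQAgent m) (T : ℕ) {Ω : Type*}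
    [MeasurableSpace Ω] (P : Measure Ω) (X₀ : ∀ i, Ω → (agents i).State)
    (N : ∀ i, ℕ → Ω → (agents i).State) : Set (Fin M → ℕ → Ω → Fin m → ℝ) :=
  {U | ∀ t < T, (∀ i, Measurable[centralInformation agents X₀ N t] (U i t)) ∧
    ∀ᵐ ω ∂P, ∑ i, U i t ω = 0}

/-- The realized total cost `∑_{t=0}^{T-1} ∑_i (X_iᵀ Q_i X_i + U_iᵀ R_i U_i)`. -/
def totalCost {M m : ℕ} (agents : Fin M → LQAgent m) (T : ℕ) {Ω : Type*}
    (X₀ : ∀ i, Ω → (agents i).State) (N : ∀ i, ℕ → Ω → (agents i).State)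
    (U : Fin M → ℕ → Ω → Fin m → ℝ) (ω : Ω) : ℝ :=
  ∑ t ∈ Finset.range T, ∑ i,
    (agents i).stageCost ((agents i).closedLoopState (X₀ i) (N i) (U i) t ω) (U i t ω)

/-- The expected social welfare, i.e. the negative of the expected total cost. The total cost is
nonnegative, so its expectation is taken in `[0, ∞]`. -/
noncomputable def socialWelfare {M m : ℕ} (agents : Fin M → LQAgent m) (T : ℕ) {Ω : Type*}
    [MeasurableSpace Ω] (P : Measure Ω) (X₀ : ∀ i, Ω → (agents i).State)
    (N : ∀ i, ℕ → Ω → (agents i).State) (U : Fin M → ℕ → Ω → Fin m → ℝ) : EReal :=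
  -((∫⁻ ω, ENNReal.ofReal (totalCost agents T X₀ N U ω) ∂P : ℝ≥0∞) : EReal)

/-!
The scheme is optimal because of two facts about linear-quadratic problems.

*Decentralization by prices.* After completing the square (`QuadraticForm.exists_completeSquare`),
an agent's optimal bid is a linear function of its state and the prices (`LQAgent.bidMap`), and its
reaction to prices is negative definite (`LQAgent.dotProduct_bidMap_neg`). The price update is
therefore a gradient iteration for an affine monotone map, and it converges when the step sizes
vanish but are not summable (`tendsto_zero_of_gradient_step`, `exists_tendsto_price`). At the limit
the bids balance, so that the payments cancel in the aggregate, and individual optimality turns into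
joint optimality among balanced plans (`bidMap_eq_balancedPlan`). Since that optimal plan is unique,
the implemented inputs are the linear feedback `feedback`, whatever the initial prices were.

*Certainty equivalence.* The value `jointValue` of the balanced noise-free problem is a quadratic
form that satisfies the Bellman equation, with `feedback` attaining the minimum. A centred noise,
independent of the present information, adds to the expectation of a quadratic form a constant that
does not depend on the control law (`integral_quadraticForm_add`). Summing over time, the expected
cost of a square-integrable law is `optimalCost` plus the expected Bellman gaps
(`integral_totalCost`). The gaps are nonnegative for balanced inputs and vanish for the feedback
law. Laws that are not square integrable have infinite cost, because each `R` is positive definite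
(`memLp_input_of_lintegral_ne_top`).
-/

/-! ### Quadratic forms in finite dimension -/

/-- Completing the square: a quadratic form on `E × F` that is positive definite in the second
variable has, for each value of the first variable, a minimizer in the second one, and this
minimizer depends linearly on the first variable. -/
theorem QuadraticForm.exists_completeSquare {E F : Type*} [AddCommGroup E] [Module ℝ E]
    [AddCommGroup F] [Module ℝ F] [FiniteDimensional ℝ F] (q : QuadraticForm ℝ (E × F))
    (hq : ∀ f, f ≠ 0 → 0 < q (0, f)) :
    ∃ L : E →ₗ[ℝ] F, ∀ x f, q (x, f) = q (x, L x) + q (0, f - L x) := by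
  let C : E →ₗ[ℝ] Module.Dual ℝ F :=
    q.polarBilin.compl₁₂ (LinearMap.inl ℝ E F) (LinearMap.inr ℝ E F)
  let H : F →ₗ[ℝ] Module.Dual ℝ F :=
    q.polarBilin.compl₁₂ (LinearMap.inr ℝ E F) (LinearMap.inr ℝ E F)
  have hH : Function.Injective H := by
    rw [injective_iff_map_eq_zero]
    intro f hf
    by_contra hne
    have h : QuadraticMap.polar q (0, f) (0, f) = 0 := congrArg (fun φ => φ f) hf
    rw [QuadraticMap.polar_self] at h
    have := hq f hne
    simp at h
    linarith
  let e := LinearEquiv.ofInjectiveOfFinrankEq H hH Subspace.dual_finrank_eq.symm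
  refine ⟨-(e.symm.toLinearMap ∘ₗ C), fun x f => ?_⟩
  set y := (-(e.symm.toLinearMap ∘ₗ C)) x with hy
  have hHy : H y = -C x := by
    have h : e y = -C x := by simp [hy]
    exact h
  have hpol : ∀ g, QuadraticMap.polar q (x, y) (0, g) = 0 := by
    intro g
    have h1 : QuadraticMap.polar q (0, y) (0, g) = -QuadraticMap.polar q (x, 0) (0, g) :=
      congrArg (fun φ => φ g) hHy
    have h2 : ((x, y) : E × F) = (x, 0) + (0, y) := by simp
    rw [h2, QuadraticMap.polar_add_left, h1, add_neg_cancel]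
  have h3 : ((x, f) : E × F) = (x, y) + (0, f - y) := by simp
  conv_lhs => rw [h3]
  rw [QuadraticMap.map_add (⇑q), hpol, add_zero]

theorem QuadraticForm.continuous_of_finiteDimensional {V : Type*} [NormedAddCommGroup V]
    [NormedSpace ℝ V] [FiniteDimensional ℝ V] (q : QuadraticForm ℝ V) : Continuous q := by
  have h : (q : V → ℝ) = fun v => (2 : ℝ)⁻¹ * q.polarBilin.toContinuousBilinearMap v v := by
    ext v
    simp
  rw [h]
  fun_prop

/-- In finite dimension a positive definite form dominates every quadratic form, by compactness
of the unit sphere. -/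
theorem QuadraticForm.exists_le_mul_of_posDef {V : Type*} [NormedAddCommGroup V]
    [NormedSpace ℝ V] [FiniteDimensional ℝ V] (p q : QuadraticForm ℝ V) (hq : q.PosDef) :
    ∃ C > 0, ∀ v, p v ≤ C * q v := by
  have hK : IsCompact (Metric.sphere (0 : V) 1) := isCompact_sphere 0 1
  have hne : ∀ v ∈ Metric.sphere (0 : V) 1, v ≠ 0 := fun v hv h => by simp [h] at hv
  obtain ⟨C, hC⟩ := hK.bddAbove_image (f := fun v => p v / q v)
    (p.continuous_of_finiteDimensional.continuousOn.div
      q.continuous_of_finiteDimensional.continuousOn fun v hv => (hq v (hne v hv)).ne')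
  refine ⟨max C 1, by positivity, fun v => ?_⟩
  rcases eq_or_ne v 0 with rfl | hv
  · simp
  have hn : ‖v‖ ≠ 0 := norm_ne_zero_iff.2 hv
  set w := ‖v‖⁻¹ • v with hw
  have hws : w ∈ Metric.sphere (0 : V) 1 := by simp [hw, norm_smul, hn]
  have hwv : v = ‖v‖ • w := by simp [hw, smul_smul, hn]
  have h1 : p w ≤ max C 1 * q w := by
    have h := (hC ⟨w, hws, rfl⟩).trans (le_max_left C 1)
    exact (div_le_iff₀ (hq w (hne w hws))).1 h
  have hscale : ∀ r : QuadraticForm ℝ V, r v = ‖v‖ * ‖v‖ * r w := fun r => by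
    conv_lhs => rw [hwv, QuadraticMap.map_smul, smul_eq_mul]
  rw [hscale p, hscale q, mul_left_comm]
  exact mul_le_mul_of_nonneg_left h1 (mul_self_nonneg _)

/-! ### The priced problem of a single agent -/

namespace LQAgent

variable {m : ℕ} (a : LQAgent m)

/-- The one-step cost as a quadratic form in the pair (state, input). -/
noncomputable def stageForm : QuadraticForm ℝ (a.State × (Fin m → ℝ)) :=
  a.Q.toQuadraticForm'.comp (LinearMap.fst ℝ _ _) + a.R.toQuadraticForm'.comp (LinearMap.snd ℝ _ _)

theorem stageForm_apply (z : a.State × (Fin m → ℝ)) : a.stageForm z = a.stageCost z.1 z.2 := by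
  simp [stageForm, stageCost, Matrix.toQuadraticForm', LinearMap.BilinMap.toQuadraticMap_apply,
    Matrix.toLinearMap₂'_apply']

/-- The noise-free dynamics `(x, u) ↦ A x + B u` as a linear map. -/
noncomputable def step : a.State × (Fin m → ℝ) →ₗ[ℝ] a.State :=
  a.A.mulVecLin ∘ₗ LinearMap.fst ℝ _ _ + a.B.mulVecLin ∘ₗ LinearMap.snd ℝ _ _

/-- The cost of the input sequence `u(0), …, u(n-1)` over `n` noise-free steps from the state `x`,
as a quadratic form in the pair `(x, u)`. Since the dynamics do not depend on time, only the
number of remaining steps matters. -/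
noncomputable def planCost : (n : ℕ) → QuadraticForm ℝ (a.State × (Fin n → Fin m → ℝ))
  | 0 => 0
  | n + 1 =>
    let z := (LinearMap.fst ℝ a.State (Fin (n + 1) → Fin m → ℝ)).prod
      (LinearMap.proj 0 ∘ₗ LinearMap.snd ℝ _ _)
    a.stageForm.comp z +
      (planCost n).comp ((a.step ∘ₗ z).prod
        (LinearMap.funLeft ℝ (Fin m → ℝ) Fin.succ ∘ₗ LinearMap.snd ℝ _ _))

theorem planCost_zero (x : a.State) (u : Fin 0 → Fin m → ℝ) : a.planCost 0 (x, u) = 0 := rfl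

theorem planCost_succ (n : ℕ) (x : a.State) (u : Fin (n + 1) → Fin m → ℝ) :
    a.planCost (n + 1) (x, u) =
      a.stageCost x (u 0) + a.planCost n (a.step (x, u 0), fun t => u t.succ) := by
  simp only [planCost, _root_.add_apply, QuadraticMap.comp_apply, stageForm_apply]
  rfl

theorem inputCost_pos {u : Fin m → ℝ} (hu : u ≠ 0) : 0 < u ⬝ᵥ (a.R *ᵥ u) := by
  simpa using a.R_posDef.dotProduct_mulVec_pos hu

theorem stateCost_nonneg (x : a.State) : 0 ≤ x ⬝ᵥ (a.Q *ᵥ x) := by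
  simpa using a.Q_posSemidef.dotProduct_mulVec_nonneg x

theorem inputCost_nonneg (u : Fin m → ℝ) : 0 ≤ u ⬝ᵥ (a.R *ᵥ u) := by
  simpa using a.R_posDef.posSemidef.dotProduct_mulVec_nonneg u

theorem stageCost_nonneg (x : a.State) (u : Fin m → ℝ) : 0 ≤ a.stageCost x u :=
  add_nonneg (a.stateCost_nonneg x) (a.inputCost_nonneg u)

theorem planCost_nonneg (n : ℕ) (x : a.State) (u : Fin n → Fin m → ℝ) :
    0 ≤ a.planCost n (x, u) := by
  induction n generalizing x with
  | zero => exact (a.planCost_zero x u).ge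
  | succ n ih => rw [planCost_succ]; exact add_nonneg (a.stageCost_nonneg _ _) (ih _ _)

theorem planCost_pos (n : ℕ) (x : a.State) {u : Fin n → Fin m → ℝ} (hu : u ≠ 0) :
    0 < a.planCost n (x, u) := by
  induction n generalizing x with
  | zero => exact absurd (Subsingleton.elim u 0) hu
  | succ n ih =>
    rw [planCost_succ]
    by_cases h0 : u 0 = 0
    · refine add_pos_of_nonneg_of_pos (a.stageCost_nonneg _ _) (ih _ fun h => hu ?_)
      ext t : 1
      refine Fin.cases h0 (fun t => congrFun h t) t
    · exact add_pos_of_pos_of_nonneg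
        (add_pos_of_nonneg_of_pos (a.stateCost_nonneg x) (a.inputCost_pos h0))
        (a.planCost_nonneg _ _ _)

/-- The price-augmented cost over `n` steps, as a quadratic form in `((x, p), u)`. The payment is
linear in the inputs `u` but bilinear in `(p, u)`, so treating the prices `p` as a parameter
alongside the state `x` makes the whole cost homogeneous of degree two. -/
noncomputable def pricedForm (n : ℕ) :
    QuadraticForm ℝ ((a.State × (Fin n → Fin m → ℝ)) × (Fin n → Fin m → ℝ)) :=
  (a.planCost n).comp ((LinearMap.fst ℝ _ _ ∘ₗ LinearMap.fst ℝ _ _).prod (LinearMap.snd ℝ _ _)) +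
    ∑ t, ∑ c, QuadraticMap.linMulLin
      (LinearMap.proj c ∘ₗ LinearMap.proj t ∘ₗ LinearMap.snd ℝ _ _ ∘ₗ LinearMap.fst ℝ _ _)
      (LinearMap.proj c ∘ₗ LinearMap.proj t ∘ₗ LinearMap.snd ℝ _ _)

theorem pricedForm_apply (n : ℕ) (x : a.State) (p u : Fin n → Fin m → ℝ) :
    a.pricedForm n ((x, p), u) = a.planCost n (x, u) + ∑ t, p t ⬝ᵥ u t := by
  simp [pricedForm, dotProduct]

theorem exists_bidMap (n : ℕ) : ∃ L : a.State × (Fin n → Fin m → ℝ) →ₗ[ℝ] (Fin n → Fin m → ℝ),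
    ∀ z u, a.pricedForm n (z, u) = a.pricedForm n (z, L z) + a.planCost n (0, u - L z) := by
  obtain ⟨L, hL⟩ := QuadraticForm.exists_completeSquare (a.pricedForm n) fun u hu => by
    have := a.pricedForm_apply n 0 0 u
    simp only [Prod.mk_zero_zero] at this
    rw [this]
    simpa using a.planCost_pos n 0 hu
  refine ⟨L, fun z u => ?_⟩
  have := a.pricedForm_apply n 0 0 (u - L z)
  simp only [Prod.mk_zero_zero] at this
  rw [hL z u, this]
  simp

/-- The optimal bid over `n` steps, a linear function of the pair (state, prices). -/
noncomputable def bidMap (n : ℕ) :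
    a.State × (Fin n → Fin m → ℝ) →ₗ[ℝ] (Fin n → Fin m → ℝ) := (a.exists_bidMap n).choose

theorem pricedForm_eq (n : ℕ) (z : a.State × (Fin n → Fin m → ℝ)) (u : Fin n → Fin m → ℝ) :
    a.pricedForm n (z, u) =
      a.pricedForm n (z, a.bidMap n z) + a.planCost n (0, u - a.bidMap n z) :=
  (a.exists_bidMap n).choose_spec z u

/-- The priced problem has exactly one minimizer, namely the value of `bidMap`. -/
theorem eq_bidMap_iff (n : ℕ) (z : a.State × (Fin n → Fin m → ℝ)) (u : Fin n → Fin m → ℝ) :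
    (∀ v, a.pricedForm n (z, u) ≤ a.pricedForm n (z, v)) ↔ u = a.bidMap n z := by
  constructor
  · intro h
    by_contra hne
    have h1 := h (a.bidMap n z)
    rw [a.pricedForm_eq n z u] at h1
    have := a.planCost_pos n 0 (sub_ne_zero.2 hne)
    linarith
  · rintro rfl v
    rw [a.pricedForm_eq n z v]
    have := a.planCost_nonneg n 0 (v - a.bidMap n z)
    linarith

/-- The entries `u(s), …, u(s+n-1)` of a sequence. -/
def window {m : ℕ} (s n : ℕ) (u : ℕ → Fin m → ℝ) : Fin n → Fin m → ℝ := fun t => u (s + t)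

theorem pricedCost_eq (s n : ℕ) {x₀ : a.State} {price : ℕ → Fin m → ℝ} {x : ℕ → a.State}
    {u : ℕ → Fin m → ℝ} (h : a.IsPlan s (s + n) x₀ x u) :
    a.pricedCost s (s + n) price x u =
      a.pricedForm n ((x₀, window s n price), window s n u) := by
  rw [pricedForm_apply]
  induction n generalizing s x₀ with
  | zero => simp [pricedCost, planCost_zero]
  | succ n ih =>
    have e : s + (n + 1) = (s + 1) + n := by omega
    have h' : a.IsPlan (s + 1) (s + 1 + n) (a.step (x₀, u s)) x u := by
      refine ⟨?_, fun t h1 h2 => h.2 t (by omega) (by omega)⟩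
      rw [h.2 s le_rfl (by omega), h.1]; rfl
    have hw : ∀ w : ℕ → Fin m → ℝ, (fun t : Fin n => window s (n + 1) w t.succ) =
        window (s + 1) n w := fun w => by
      ext t c
      simp only [window, Fin.val_succ]
      rw [show s + (t + 1 : ℕ) = s + 1 + t by omega]
    have ih' := ih (s + 1) h'
    rw [pricedCost] at ih' ⊢
    rw [Finset.sum_eq_sum_Ico_succ_bot (by omega), e, ih', planCost_succ, hw, Fin.sum_univ_succ, h.1]
    have hw' := fun w => congrFun (hw w)
    simp only [hw']
    simp only [window, Fin.val_zero, add_zero]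
    ring

theorem exists_isPlan (s T : ℕ) (x₀ : a.State) (u : ℕ → Fin m → ℝ) : ∃ x, a.IsPlan s T x₀ x u := by
  let y : ℕ → a.State := fun k => Nat.rec x₀ (fun k z => a.A *ᵥ z + a.B *ᵥ u (s + k)) k
  refine ⟨fun t => y (t - s), by simp [y], fun t hs _ => ?_⟩
  obtain ⟨k, rfl⟩ := Nat.exists_eq_add_of_le hs
  simp only [show s + k + 1 - s = k + 1 by omega, show s + k - s = k by omega, y]

/-- The sequence with entries `v` at the times `s, …, s+n-1` and zero from time `s+n` on. Because
of truncated subtraction its entries before time `s` are `v 0` if `0 < n`; they are never used. -/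
def extendPlan {m : ℕ} (s n : ℕ) (v : Fin n → Fin m → ℝ) : ℕ → Fin m → ℝ :=
  fun t => if h : t - s < n then v ⟨t - s, h⟩ else 0

theorem window_extendPlan {m : ℕ} (s n : ℕ) (v : Fin n → Fin m → ℝ) :
    window s n (extendPlan s n v) = v := by
  ext t
  simp [window, extendPlan]

/-- A bid is optimal exactly if its entries at the times `s, …, s+n-1` are those of `bidMap`. -/
theorem isOptimalBid_iff (s n : ℕ) (x₀ : a.State) (price u : ℕ → Fin m → ℝ) :
    a.IsOptimalBid s (s + n) x₀ price u ↔
      window s n u = a.bidMap n (x₀, window s n price) := by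
  rw [← eq_bidMap_iff]
  constructor
  · rintro ⟨x, hx, hopt⟩ v
    obtain ⟨x', hx'⟩ := a.exists_isPlan s (s + n) x₀ (extendPlan s n v)
    have h := hopt x' _ hx'
    rwa [a.pricedCost_eq s n hx, a.pricedCost_eq s n hx', window_extendPlan] at h
  · intro h
    obtain ⟨x, hx⟩ := a.exists_isPlan s (s + n) x₀ u
    refine ⟨x, hx, fun x' u' hx' => ?_⟩
    rw [a.pricedCost_eq s n hx, a.pricedCost_eq s n hx']
    exact h _

/-- Demand is strictly decreasing in the prices: the response of a bid to a nonzero price change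
has negative inner product with that change. -/
theorem dotProduct_bidMap_neg (n : ℕ) {p : Fin n → Fin m → ℝ} (hp : p ≠ 0) :
    ∑ t, p t ⬝ᵥ a.bidMap n (0, p) t < 0 := by
  set v := a.bidMap n (0, p) with hv
  have key : ∀ u, a.planCost n (0, u) + ∑ t, p t ⬝ᵥ u t =
      a.planCost n (0, v) + ∑ t, p t ⬝ᵥ v t + a.planCost n (0, u - v) := fun u => by
    have := a.pricedForm_eq n (0, p) u
    rwa [pricedForm_apply, pricedForm_apply] at this
  have h0 := key 0
  have hz : a.planCost n ((0 : a.State), (0 : Fin n → Fin m → ℝ)) = 0 := by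
    rw [Prod.mk_zero_zero, QuadraticMap.map_zero]
  -- comparing with the zero bid gives `p · v = -2 planCost (0, v)`
  have hneg : a.planCost n ((0 : a.State), 0 - v) = a.planCost n (0, v) := by
    rw [← QuadraticMap.map_neg]; simp
  rw [hz, hneg] at h0
  simp only [Pi.zero_apply, dotProduct_zero, Finset.sum_const_zero, add_zero] at h0
  -- if the bid did not react to `p`, then `p` itself would be an input with zero payment
  have hvne : v ≠ 0 := by
    intro hv0
    apply hp
    have := key p
    rw [hv0, hz] at this
    simp only [Pi.zero_apply, dotProduct_zero, Finset.sum_const_zero, add_zero, zero_add,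
      sub_zero] at this
    have hsum : ∑ t, p t ⬝ᵥ p t = 0 := by linarith
    ext t : 1
    exact dotProduct_self_eq_zero.1
      ((Finset.sum_eq_zero_iff_of_nonneg fun t _ =>
        Finset.sum_nonneg fun c _ => mul_self_nonneg (p t c)).1 hsum t (Finset.mem_univ t))
  have := a.planCost_pos n 0 hvne
  linarith

end LQAgent

/-! ### The balanced problem of all agents -/

section Joint

variable {M m : ℕ} (agents : Fin M → LQAgent m)

/-- The state space of all agents together. -/
abbrev JointState : Type := ∀ i, (agents i).State

/-- The sum of the agents' costs over `n` noise-free steps. -/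
noncomputable def jointPlanCost (n : ℕ) :
    QuadraticForm ℝ (JointState agents × (Fin M → Fin n → Fin m → ℝ)) :=
  ∑ i, ((agents i).planCost n).comp
    ((LinearMap.proj i ∘ₗ LinearMap.fst ℝ _ _).prod (LinearMap.proj i ∘ₗ LinearMap.snd ℝ _ _))

theorem jointPlanCost_apply (n : ℕ) (x : JointState agents) (u : Fin M → Fin n → Fin m → ℝ) :
    jointPlanCost agents n (x, u) = ∑ i, (agents i).planCost n (x i, u i) := by
  simp [jointPlanCost]

theorem jointPlanCost_pos (n : ℕ) (x : JointState agents) {u : Fin M → Fin n → Fin m → ℝ}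
    (hu : u ≠ 0) : 0 < jointPlanCost agents n (x, u) := by
  rw [jointPlanCost_apply]
  obtain ⟨i, hi⟩ := Function.ne_iff.1 hu
  exact Finset.sum_pos' (fun i _ => (agents i).planCost_nonneg n _ _)
    ⟨i, Finset.mem_univ i, (agents i).planCost_pos n _ hi⟩

theorem jointPlanCost_nonneg (n : ℕ) (x : JointState agents) (u : Fin M → Fin n → Fin m → ℝ) :
    0 ≤ jointPlanCost agents n (x, u) := by
  rw [jointPlanCost_apply]
  exact Finset.sum_nonneg fun i _ => (agents i).planCost_nonneg n _ _

theorem exists_balancedPlan (n : ℕ) :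
    ∃ L : JointState agents →ₗ[ℝ] (Fin M → Fin n → Fin m → ℝ), (∀ x, ∑ i, L x i = 0) ∧
      ∀ x u, ∑ i, u i = 0 → jointPlanCost agents n (x, u) =
        jointPlanCost agents n (x, L x) + jointPlanCost agents n (0, u - L x) := by
  let S : Submodule ℝ (Fin M → Fin n → Fin m → ℝ) := LinearMap.ker (∑ i, LinearMap.proj i)
  have hS : ∀ u, u ∈ S ↔ ∑ i, u i = 0 := fun u => by simp [S]
  obtain ⟨L, hL⟩ := QuadraticForm.exists_completeSquare
    ((jointPlanCost agents n).comp
      ((LinearMap.fst ℝ (JointState agents) S).prod (S.subtype ∘ₗ LinearMap.snd ℝ _ _)))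
    fun u hu => jointPlanCost_pos agents n 0 (by simpa using hu)
  exact ⟨S.subtype ∘ₗ L, fun x => (hS _).1 (L x).2, fun x u hu => hL x ⟨u, (hS u).2 hu⟩⟩

/-- The minimizer of the joint cost over `n` steps among the balanced plans, a linear function of
the joint state. -/
noncomputable def balancedPlan (n : ℕ) :
    JointState agents →ₗ[ℝ] (Fin M → Fin n → Fin m → ℝ) :=
  (exists_balancedPlan agents n).choose

theorem sum_balancedPlan (n : ℕ) (x : JointState agents) : ∑ i, balancedPlan agents n x i = 0 :=
  (exists_balancedPlan agents n).choose_spec.1 x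

theorem jointPlanCost_eq (n : ℕ) (x : JointState agents) {u : Fin M → Fin n → Fin m → ℝ}
    (hu : ∑ i, u i = 0) :
    jointPlanCost agents n (x, u) = jointPlanCost agents n (x, balancedPlan agents n x) +
      jointPlanCost agents n (0, u - balancedPlan agents n x) :=
  (exists_balancedPlan agents n).choose_spec.2 x u hu

theorem eq_balancedPlan (n : ℕ) (x : JointState agents) {u : Fin M → Fin n → Fin m → ℝ}
    (hu : ∑ i, u i = 0)
    (hmin : ∀ v, ∑ i, v i = 0 → jointPlanCost agents n (x, u) ≤ jointPlanCost agents n (x, v)) :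
    u = balancedPlan agents n x := by
  by_contra hne
  have h1 := hmin _ (sum_balancedPlan agents n x)
  rw [jointPlanCost_eq agents n x hu] at h1
  have := jointPlanCost_pos agents n 0 (sub_ne_zero.2 hne)
  linarith

/-- The minimal joint cost over `n` noise-free steps with balanced inputs, a quadratic form in the
joint state. -/
noncomputable def jointValue (n : ℕ) : QuadraticForm ℝ (JointState agents) :=
  (jointPlanCost agents n).comp (LinearMap.id.prod (balancedPlan agents n))

theorem jointValue_apply (n : ℕ) (x : JointState agents) :
    jointValue agents n x = jointPlanCost agents n (x, balancedPlan agents n x) := rfl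

theorem jointValue_zero (x : JointState agents) : jointValue agents 0 x = 0 := by
  simp [jointValue_apply, jointPlanCost_apply, LQAgent.planCost_zero]

theorem jointValue_le (n : ℕ) (x : JointState agents) {u : Fin M → Fin n → Fin m → ℝ}
    (hu : ∑ i, u i = 0) : jointValue agents n x ≤ jointPlanCost agents n (x, u) := by
  rw [jointPlanCost_eq agents n x hu, jointValue_apply]
  exact le_add_of_nonneg_right (jointPlanCost_nonneg agents n _ _)

/-- The first entry of the optimal balanced plan when `n + 1` steps remain. -/
noncomputable def feedback (n : ℕ) : JointState agents →ₗ[ℝ] (Fin M → Fin m → ℝ) :=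
  LinearMap.pi fun i => LinearMap.proj 0 ∘ₗ LinearMap.proj i ∘ₗ balancedPlan agents (n + 1)

theorem feedback_apply (n : ℕ) (x : JointState agents) (i : Fin M) :
    feedback agents n x i = balancedPlan agents (n + 1) x i 0 := rfl

theorem sum_feedback (n : ℕ) (x : JointState agents) : ∑ i, feedback agents n x i = 0 := by
  have := congrFun (sum_balancedPlan agents (n + 1) x) 0
  rwa [Finset.sum_apply] at this

/-- The noise-free dynamics of all agents together. -/
noncomputable def jointStep :
    JointState agents × (Fin M → Fin m → ℝ) →ₗ[ℝ] JointState agents :=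
  LinearMap.pi fun i => (agents i).step ∘ₗ
    ((LinearMap.proj i ∘ₗ LinearMap.fst ℝ _ _).prod (LinearMap.proj i ∘ₗ LinearMap.snd ℝ _ _))

/-- The one-step cost of all agents together. -/
noncomputable def jointStageForm : QuadraticForm ℝ (JointState agents × (Fin M → Fin m → ℝ)) :=
  ∑ i, (agents i).stageForm.comp
    ((LinearMap.proj i ∘ₗ LinearMap.fst ℝ _ _).prod (LinearMap.proj i ∘ₗ LinearMap.snd ℝ _ _))

theorem jointStageForm_apply (x : JointState agents) (v : Fin M → Fin m → ℝ) :
    jointStageForm agents (x, v) = ∑ i, (agents i).stageCost (x i) (v i) := by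
  simp [jointStageForm, LQAgent.stageForm_apply]

theorem jointPlanCost_succ (n : ℕ) (x : JointState agents)
    (u : Fin M → Fin (n + 1) → Fin m → ℝ) :
    jointPlanCost agents (n + 1) (x, u) = jointStageForm agents (x, fun i => u i 0) +
      jointPlanCost agents n (jointStep agents (x, fun i => u i 0), fun i t => u i t.succ) := by
  simp only [jointPlanCost_apply, jointStageForm_apply, LQAgent.planCost_succ,
    Finset.sum_add_distrib]
  rfl

/-- One half of the Bellman equation: a balanced input followed by the optimal balanced plan from
the next state is a balanced plan. -/
theorem jointValue_succ_le (n : ℕ) (x : JointState agents) {v : Fin M → Fin m → ℝ}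
    (hv : ∑ i, v i = 0) : jointValue agents (n + 1) x ≤
      jointStageForm agents (x, v) + jointValue agents n (jointStep agents (x, v)) := by
  let u : Fin M → Fin (n + 1) → Fin m → ℝ := fun i =>
    Fin.cons (v i) (balancedPlan agents n (jointStep agents (x, v)) i)
  have hu : ∑ i, u i = 0 := by
    ext t : 1
    rw [Finset.sum_apply]
    refine Fin.cases ?_ (fun t => ?_) t
    · simpa [u] using hv
    · have := congrFun (sum_balancedPlan agents n (jointStep agents (x, v))) t
      rw [Finset.sum_apply] at this
      simpa [u] using this
  have h := jointValue_le agents (n + 1) x hu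
  rw [jointPlanCost_succ] at h
  simpa [u, jointValue_apply] using h

/-- The Bellman equation is attained by `feedback`: the tail of an optimal balanced plan is
balanced. -/
theorem jointValue_succ (n : ℕ) (x : JointState agents) :
    jointValue agents (n + 1) x = jointStageForm agents (x, feedback agents n x) +
      jointValue agents n (jointStep agents (x, feedback agents n x)) := by
  refine (jointValue_succ_le agents n x (sum_feedback agents n x)).antisymm ?_
  rw [jointValue_apply agents (n + 1), jointPlanCost_succ]
  refine add_le_add_right (jointValue_le agents n _ ?_) _
  ext t : 1
  have := congrFun (sum_balancedPlan agents (n + 1) x) t.succ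
  rw [Finset.sum_apply] at this ⊢
  exact this

end Joint

/-! ### Convergence of gradient iterations -/

/-- The iteration `e ↦ e - α G e` with vanishing, non-summable step sizes drives a positive definite
form `p` to zero if `p` decreases along `-G`. For small steps `p` contracts by the factor
`exp (-c α)`, and the product of these factors tends to zero. -/
theorem tendsto_zero_of_gradient_step {V : Type*} [NormedAddCommGroup V] [NormedSpace ℝ V]
    [FiniteDimensional ℝ V] (p : QuadraticForm ℝ V) (hp : p.PosDef) (G : V →ₗ[ℝ] V)
    (hG : ∀ e, e ≠ 0 → 0 < QuadraticMap.polar p e (G e)) {α : ℕ → ℝ} (hαpos : ∀ k, 0 < α k)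
    (hα0 : Tendsto α atTop (𝓝 0))
    (hαsum : Tendsto (fun n => ∑ k ∈ Finset.range n, α k) atTop atTop) {e : ℕ → V}
    (he : ∀ k, e (k + 1) = e k - α k • G (e k)) : Tendsto (fun k => p (e k)) atTop (𝓝 0) := by
  let g : QuadraticForm ℝ V :=
    LinearMap.BilinMap.toQuadraticMap (p.polarBilin.compl₁₂ LinearMap.id G)
  have hg : ∀ v, g v = QuadraticMap.polar p v (G v) := fun v => rfl
  obtain ⟨C, hC, hpg⟩ := QuadraticForm.exists_le_mul_of_posDef p g hG
  obtain ⟨D, hD, hGp⟩ := QuadraticForm.exists_le_mul_of_posDef (p.comp G) p hp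
  simp only [QuadraticMap.comp_apply] at hGp
  set c := (2 * C)⁻¹ with hc
  have hcpos : 0 < c := by positivity
  have hstep : ∀ᶠ k in atTop, p (e (k + 1)) ≤ Real.exp (-(c * α k)) * p (e k) := by
    filter_upwards [hα0.eventually (gt_mem_nhds (show 0 < c / D by positivity))] with k hk
    have h1 : p (e (k + 1)) = p (e k) - α k * g (e k) + α k * α k * p (G (e k)) := by
      rw [he, sub_eq_add_neg, QuadraticMap.map_add (⇑p), QuadraticMap.map_neg,
        QuadraticMap.map_smul, QuadraticMap.polar_neg_right, QuadraticMap.polar_smul_right, hg]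
      simp only [smul_eq_mul]
      ring
    have h2 : 2 * c * p (e k) ≤ g (e k) := by
      have h := hpg (e k)
      have h' : 2 * c * C = 1 := by rw [hc]; field_simp
      calc 2 * c * p (e k) ≤ 2 * c * (C * g (e k)) := by gcongr
        _ = g (e k) := by rw [← mul_assoc, h', one_mul]
    have h3 : α k * p (G (e k)) ≤ c * p (e k) := by
      have h4 : α k * D ≤ c := ((lt_div_iff₀ hD).1 hk).le
      calc α k * p (G (e k)) ≤ α k * (D * p (e k)) :=
            mul_le_mul_of_nonneg_left (hGp _) (hαpos k).le
        _ = α k * D * p (e k) := by ring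
        _ ≤ c * p (e k) := mul_le_mul_of_nonneg_right h4 (hp.nonneg _)
    calc p (e (k + 1)) ≤ (-(c * α k) + 1) * p (e k) := by
          rw [h1]
          nlinarith [mul_le_mul_of_nonneg_left h2 (hαpos k).le,
            mul_le_mul_of_nonneg_left h3 (hαpos k).le]
      _ ≤ Real.exp (-(c * α k)) * p (e k) :=
          mul_le_mul_of_nonneg_right (Real.add_one_le_exp _) (hp.nonneg _)
  obtain ⟨K, hK⟩ := eventually_atTop.1 hstep
  -- beyond round `K`, the quantity `exp (c * ∑ α) * p (e ·)` no longer increases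
  have hbound : ∀ k, K ≤ k → p (e k) ≤ Real.exp (-(c * ∑ j ∈ Finset.range k, α j)) *
      (Real.exp (c * ∑ j ∈ Finset.range K, α j) * p (e K)) := by
    intro k hk
    induction k, hk using Nat.le_induction with
    | base => rw [← mul_assoc, ← Real.exp_add]; simp
    | succ k hk ih =>
      refine (hK k hk).trans ((mul_le_mul_of_nonneg_left ih (Real.exp_pos _).le).trans_eq ?_)
      rw [Finset.sum_range_succ, ← mul_assoc, ← Real.exp_add]
      congr 2
      ring
  have hlim : Tendsto (fun k => Real.exp (-(c * ∑ j ∈ Finset.range k, α j)) *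
      (Real.exp (c * ∑ j ∈ Finset.range K, α j) * p (e K))) atTop (𝓝 0) := by
    simpa using (Real.tendsto_exp_neg_atTop_nhds_zero.comp
      (hαsum.const_mul_atTop hcpos)).mul_const
        (Real.exp (c * ∑ j ∈ Finset.range K, α j) * p (e K))
  exact squeeze_zero' (.of_forall fun k => hp.nonneg _)
    (eventually_atTop.2 ⟨K, fun k hk => hbound k hk⟩) hlim

/-! ### The bid-price iteration -/

section Iteration

variable {M m : ℕ} (agents : Fin M → LQAgent m)

open LQAgent

/-- The price iteration converges to market-clearing prices. For at least one agent, the aggregate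
demand is an affine function of the prices with negative definite linear part, so clearing prices
exist and the deviation from them follows a gradient iteration. -/
theorem exists_tendsto_price (n : ℕ) (x : JointState agents) {α : ℕ → ℝ} (hαpos : ∀ k, 0 < α k)
    (hα0 : Tendsto α atTop (𝓝 0))
    (hαsum : Tendsto (fun n => ∑ k ∈ Finset.range n, α k) atTop atTop)
    {p : ℕ → Fin n → Fin m → ℝ}
    (hp : ∀ k, p (k + 1) = p k + α k • ∑ i, (agents i).bidMap n (x i, p k)) :
    ∃ l, Tendsto p atTop (𝓝 l) ∧ ∑ i, (agents i).bidMap n (x i, l) = 0 := by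
  -- without agents the prices never move
  rcases isEmpty_or_nonempty (Fin M) with hM | hM
  · refine ⟨p 0, tendsto_const_nhds.congr fun k => ?_, Fintype.sum_empty _⟩
    induction k with
    | zero => rfl
    | succ k ih => rw [hp, Fintype.sum_empty, smul_zero, add_zero, ih]
  let G : (Fin n → Fin m → ℝ) →ₗ[ℝ] (Fin n → Fin m → ℝ) :=
    -∑ i, (agents i).bidMap n ∘ₗ LinearMap.inr ℝ _ _
  have hGsum : ∀ q r, ∑ i, (agents i).bidMap n (x i, q) =
      ∑ i, (agents i).bidMap n (x i, r) - G (q - r) := by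
    intro q r
    have : G (q - r) = -∑ i, (agents i).bidMap n (0, q - r) := by simp [G]
    rw [this, sub_neg_eq_add, ← Finset.sum_add_distrib]
    refine Finset.sum_congr rfl fun i _ => ?_
    rw [← map_add]
    simp
  let sq : QuadraticForm ℝ (Fin n → Fin m → ℝ) :=
    ∑ t, ∑ c, QuadraticMap.sq.comp (LinearMap.proj c ∘ₗ LinearMap.proj t)
  have hsq : ∀ v, sq v = ∑ t, ∑ c, v t c * v t c := fun v => by simp [sq]
  have hle : ∀ v t c, v t c * v t c ≤ sq v := fun v t c => by
    rw [hsq]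
    exact (Finset.single_le_sum (f := fun c => v t c * v t c)
      (fun c _ => mul_self_nonneg _) (Finset.mem_univ c)).trans
      (Finset.single_le_sum (f := fun t => ∑ c, v t c * v t c)
        (fun t _ => Finset.sum_nonneg fun c _ => mul_self_nonneg _) (Finset.mem_univ t))
  have hpolar : ∀ v w, QuadraticMap.polar sq v w = 2 * ∑ t, v t ⬝ᵥ w t := fun v w => by
    simp only [QuadraticMap.polar, hsq, dotProduct, Finset.mul_sum, ← Finset.sum_sub_distrib,
      Pi.add_apply]
    refine Finset.sum_congr rfl fun t _ => Finset.sum_congr rfl fun c _ => ?_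
    ring
  have hsqpos : sq.PosDef := by
    intro v hv
    obtain ⟨t, ht⟩ := Function.ne_iff.1 hv
    obtain ⟨c, hc⟩ := Function.ne_iff.1 ht
    exact (mul_self_pos.2 hc).trans_le (hle v t c)
  have hGpos : ∀ v, v ≠ 0 → 0 < QuadraticMap.polar sq v (G v) := by
    intro v hv
    have h1 : ∑ t, v t ⬝ᵥ G v t = -∑ i, ∑ t, v t ⬝ᵥ (agents i).bidMap n (0, v) t := by
      rw [Finset.sum_comm, ← Finset.sum_neg_distrib]
      refine Finset.sum_congr rfl fun t _ => ?_
      rw [← dotProduct_sum, ← dotProduct_neg]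
      simp [G]
    rw [hpolar, h1]
    have := Finset.sum_neg (s := Finset.univ) (fun i _ => (agents i).dotProduct_bidMap_neg n hv)
      Finset.univ_nonempty
    linarith
  have hGinj : Function.Injective G := by
    rw [injective_iff_map_eq_zero]
    intro v hv
    by_contra hne
    have := hGpos v hne
    rw [hv, QuadraticMap.polar_zero_right] at this
    exact lt_irrefl _ this
  obtain ⟨l, hl⟩ := (LinearMap.injective_iff_surjective.1 hGinj)
    (∑ i, (agents i).bidMap n (x i, 0))
  have hl0 : ∑ i, (agents i).bidMap n (x i, l) = 0 := by
    rw [hGsum l 0, sub_zero, hl, sub_self]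
  refine ⟨l, ?_, hl0⟩
  have hlim := tendsto_zero_of_gradient_step sq hsqpos G hGpos hαpos hα0 hαsum
    (e := fun k => p k - l) fun k => by
      rw [hp, hGsum (p k) l, hl0, zero_sub, smul_neg]
      abel
  refine tendsto_pi_nhds.2 fun t => tendsto_pi_nhds.2 fun c => ?_
  have h2 : Tendsto (fun k => (p k - l) t c * (p k - l) t c) atTop (𝓝 0) :=
    squeeze_zero (fun k => mul_self_nonneg _) (fun k => hle _ t c) hlim
  have h3 : Tendsto (fun k => |(p k - l) t c|) atTop (𝓝 0) := by
    simpa [Function.comp_def, Real.sqrt_mul_self_eq_abs] using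
      (Real.continuous_sqrt.tendsto 0).comp h2
  have h4 := (tendsto_zero_iff_abs_tendsto_zero _).2 h3
  simpa using h4.add_const (l t c)

/-- At market-clearing prices the individually optimal bids form the jointly optimal balanced plan. -/
theorem bidMap_eq_balancedPlan (n : ℕ) (x : JointState agents) {l : Fin n → Fin m → ℝ}
    (hl : ∑ i, (agents i).bidMap n (x i, l) = 0) (i : Fin M) :
    (agents i).bidMap n (x i, l) = balancedPlan agents n x i := by
  refine congrFun (eq_balancedPlan agents n x (u := fun i => (agents i).bidMap n (x i, l)) hl
    fun v hv => ?_) i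
  -- on balanced plans the payments at the common price `l` cancel
  have hpay : ∀ w : Fin M → Fin n → Fin m → ℝ, ∑ i, w i = 0 →
      ∑ i, (agents i).pricedForm n ((x i, l), w i) = jointPlanCost agents n (x, w) := by
    intro w hw
    simp only [pricedForm_apply, Finset.sum_add_distrib, jointPlanCost_apply]
    rw [Finset.sum_comm, add_eq_left]
    refine Finset.sum_eq_zero fun t _ => ?_
    rw [← dotProduct_sum, ← Finset.sum_apply, hw, Pi.zero_apply, dotProduct_zero]
  rw [← hpay _ hl, ← hpay _ hv]
  exact Finset.sum_le_sum fun i _ => ((agents i).eq_bidMap_iff n (x i, l) _).2 rfl _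

/-- A bid-price iteration read on the times `s, …, s+n-1`, where the bids are forced. -/
theorem isBidPriceIteration_iff (s n : ℕ) (α : ℕ → ℝ) (x : JointState agents)
    (price : ℕ → ℕ → Fin m → ℝ) (bid : ℕ → Fin M → ℕ → Fin m → ℝ) :
    IsBidPriceIteration agents (s + n) α s x price bid ↔
      (∀ k i, window s n (bid k i) = (agents i).bidMap n (x i, window s n (price k))) ∧
      ∀ k, window s n (price (k + 1)) =
        window s n (price k) + α k • ∑ i, window s n (bid k i) := by
  simp only [IsBidPriceIteration, isOptimalBid_iff]
  refine and_congr_right fun _ => forall_congr' fun k => ?_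
  constructor
  · intro h
    ext t : 1
    simpa [window, Finset.sum_apply] using h (s + t) (by omega) (by omega)
  · intro h t h1 h2
    obtain ⟨j, rfl⟩ := Nat.exists_eq_add_of_le h1
    simpa [window, Finset.sum_apply] using congrFun h ⟨j, by omega⟩

theorem IsBidPriceIteration.tendsto_balancedPlan {s n : ℕ} {α : ℕ → ℝ} (hαpos : ∀ k, 0 < α k)
    (hα0 : Tendsto α atTop (𝓝 0))
    (hαsum : Tendsto (fun n => ∑ k ∈ Finset.range n, α k) atTop atTop) {x : JointState agents}
    {price : ℕ → ℕ → Fin m → ℝ} {bid : ℕ → Fin M → ℕ → Fin m → ℝ}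
    (h : IsBidPriceIteration agents (s + n) α s x price bid) :
    (∃ l, Tendsto (fun k => window s n (price k)) atTop (𝓝 l)) ∧
      ∀ i, Tendsto (fun k => window s n (bid k i)) atTop (𝓝 (balancedPlan agents n x i)) := by
  obtain ⟨hbid, hprice⟩ := (isBidPriceIteration_iff agents s n α x price bid).1 h
  simp only [hbid] at hprice
  obtain ⟨l, hl, hl0⟩ := exists_tendsto_price agents n x hαpos hα0 hαsum
    (p := fun k => window s n (price k)) hprice
  refine ⟨⟨l, hl⟩, fun i => ?_⟩
  rw [← bidMap_eq_balancedPlan agents n x hl0]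
  simp only [hbid]
  exact ((LinearMap.continuous_of_finiteDimensional ((agents i).bidMap n)).tendsto _).comp
    (tendsto_const_nhds.prodMk_nhds hl)

theorem exists_isBidPriceIteration (s n : ℕ) (α : ℕ → ℝ) (x : JointState agents)
    (price₀ : ℕ → Fin m → ℝ) : ∃ price bid,
      IsBidPriceIteration agents (s + n) α s x price bid ∧ price 0 = price₀ := by
  let answer (p : ℕ → Fin m → ℝ) (i : Fin M) : ℕ → Fin m → ℝ :=
    extendPlan s n ((agents i).bidMap n (x i, window s n p))
  let price : ℕ → ℕ → Fin m → ℝ := fun k =>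
    Nat.rec price₀ (fun k p => p + α k • ∑ i, answer p i) k
  refine ⟨price, fun k => answer (price k), ?_, rfl⟩
  rw [isBidPriceIteration_iff]
  refine ⟨fun k i => window_extendPlan s n _, fun k => ?_⟩
  ext t : 1
  simp [price, window, Finset.sum_apply]

end Iteration

/-! ### Expectations of quadratic forms -/

section Quadratic

variable {Ω V : Type*} [MeasurableSpace Ω] {P : Measure Ω} [NormedAddCommGroup V]
  [NormedSpace ℝ V] [FiniteDimensional ℝ V]

theorem MeasureTheory.MemLp.integrable_quadraticForm {Y : Ω → V} (hY : MemLp Y 2 P)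
    (q : QuadraticForm ℝ V) : Integrable (fun ω => q (Y ω)) P := by
  let B := q.polarBilin.toContinuousBilinearMap
  refine ((hY.integrable_norm_pow two_ne_zero).const_mul ‖B‖).mono'
    (q.continuous_of_finiteDimensional.comp_aestronglyMeasurable hY.1) (.of_forall fun ω => ?_)
  have h1 : B (Y ω) (Y ω) = 2 * q (Y ω) := by simp [B]
  have h2 := B.le_opNorm₂ (Y ω) (Y ω)
  rw [h1, norm_mul, Real.norm_ofNat, mul_assoc, ← sq] at h2
  linarith [norm_nonneg (q (Y ω))]

theorem MeasureTheory.MemLp.linearMap_comp {W : Type*} [NormedAddCommGroup W] [NormedSpace ℝ W]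
    {Y : Ω → V} (hY : MemLp Y 2 P) (L : V →ₗ[ℝ] W) : MemLp (fun ω => L (Y ω)) 2 P :=
  L.toContinuousLinearMap.comp_memLp' hY

/-- The expectation of a quadratic form is additive over an independent centred summand, because
the cross term has mean zero. -/
theorem integral_quadraticForm_add [IsProbabilityMeasure P] [MeasurableSpace V] [BorelSpace V]
    (q : QuadraticForm ℝ V) {Y W : Ω → V} (hY : MemLp Y 2 P) (hW : MemLp W 2 P)
    (hind : IndepFun Y W P) (hmean : ∫ ω, W ω ∂P = 0) :
    ∫ ω, q (Y ω + W ω) ∂P = ∫ ω, q (Y ω) ∂P + ∫ ω, q (W ω) ∂P := by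
  let B := q.polarBilin.toContinuousBilinearMap
  have hYi := hY.integrable one_le_two
  have hWi := hW.integrable one_le_two
  have hcross : ∫ ω, B (Y ω) (W ω) ∂P = 0 := by
    rw [hind.integral_bilin hYi hWi B, hmean, map_zero]
  have h : ∀ ω, q (Y ω + W ω) = q (Y ω) + q (W ω) + B (Y ω) (W ω) := fun ω =>
    QuadraticMap.map_add q (Y ω) (W ω)
  simp only [h]
  rw [integral_add ((hY.integrable_quadraticForm q).fun_add (hW.integrable_quadraticForm q))
    (hind.integrable_bilin hYi hWi B), hcross, add_zero,
    integral_add (hY.integrable_quadraticForm q) (hW.integrable_quadraticForm q)]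

end Quadratic

/-! ### The closed loop -/

section Dynamics

variable {M m : ℕ} {agents : Fin M → LQAgent m} {Ω : Type*}

/-- The closed-loop state of all agents together. -/
def jointProcess (X₀ : ∀ i, Ω → (agents i).State) (N : ∀ i, ℕ → Ω → (agents i).State)
    (U : Fin M → ℕ → Ω → Fin m → ℝ) (t : ℕ) (ω : Ω) : JointState agents :=
  fun i => (agents i).closedLoopState (X₀ i) (N i) (U i) t ω

theorem jointProcess_succ (X₀ : ∀ i, Ω → (agents i).State) (N : ∀ i, ℕ → Ω → (agents i).State)
    (U : Fin M → ℕ → Ω → Fin m → ℝ) (t : ℕ) (ω : Ω) :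
    jointProcess X₀ N U (t + 1) ω =
      jointStep agents (jointProcess X₀ N U t ω, fun i => U i t ω) + fun i => N i t ω := rfl

theorem totalCost_eq (T : ℕ) (X₀ : ∀ i, Ω → (agents i).State)
    (N : ∀ i, ℕ → Ω → (agents i).State) (U : Fin M → ℕ → Ω → Fin m → ℝ) (ω : Ω) :
    totalCost agents T X₀ N U ω = ∑ t ∈ Finset.range T,
      jointStageForm agents (jointProcess X₀ N U t ω, fun i => U i t ω) := by
  simp only [totalCost, jointStageForm_apply]
  rfl

theorem totalCost_nonneg (T : ℕ) (X₀ : ∀ i, Ω → (agents i).State)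
    (N : ∀ i, ℕ → Ω → (agents i).State) (U : Fin M → ℕ → Ω → Fin m → ℝ) (ω : Ω) :
    0 ≤ totalCost agents T X₀ N U ω :=
  Finset.sum_nonneg fun _ _ => Finset.sum_nonneg fun i _ => (agents i).stageCost_nonneg _ _

theorem measurable_jointStep : Measurable (jointStep agents) :=
  (LinearMap.continuous_of_finiteDimensional _).measurable

theorem measurable_initialState (X₀ : ∀ i, Ω → (agents i).State)
    (N : ∀ i, ℕ → Ω → (agents i).State) (t : ℕ) (i : Fin M) :
    Measurable[centralInformation agents X₀ N t] (X₀ i) :=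
  Measurable.mono (comap_measurable (X₀ i))
    (le_sup_of_le_left (le_iSup (fun i => MeasurableSpace.comap (X₀ i) inferInstance) i)) le_rfl

theorem measurable_noise (X₀ : ∀ i, Ω → (agents i).State)
    (N : ∀ i, ℕ → Ω → (agents i).State) {r t : ℕ} (hr : r < t) (i : Fin M) :
    Measurable[centralInformation agents X₀ N t] (N i r) :=
  Measurable.mono (comap_measurable (N i r))
    (le_sup_of_le_right (le_iSup_of_le i (le_iSup_of_le r (le_iSup_of_le hr le_rfl)))) le_rfl

theorem centralInformation_mono (X₀ : ∀ i, Ω → (agents i).State)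
    (N : ∀ i, ℕ → Ω → (agents i).State) :
    Monotone (centralInformation agents X₀ N) := fun _ _ hst =>
  sup_le_sup le_rfl (iSup_mono fun _ => iSup_mono fun _ =>
    iSup_mono' fun hr => ⟨hr.trans_le hst, le_rfl⟩)

/-- The joint state is adapted. The inputs may be feedback laws: their measurability at time `t` is
only needed once that of the state at time `t` is known. -/
theorem measurable_jointProcess {X₀ : ∀ i, Ω → (agents i).State}
    {N : ∀ i, ℕ → Ω → (agents i).State} {U : Fin M → ℕ → Ω → Fin m → ℝ} {T : ℕ}
    (hU : ∀ t < T, Measurable[centralInformation agents X₀ N t] (jointProcess X₀ N U t) →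
      ∀ i, Measurable[centralInformation agents X₀ N t] (U i t)) {t : ℕ} (ht : t ≤ T) :
    Measurable[centralInformation agents X₀ N t] (jointProcess X₀ N U t) := by
  induction t with
  | zero =>
    exact @measurable_pi_lambda _ _ _ (centralInformation agents X₀ N 0) _ _
      fun i => measurable_initialState X₀ N 0 i
  | succ t ih =>
    have hX := ih (by omega)
    have hle := centralInformation_mono X₀ N (Nat.le_succ t)
    let _ := centralInformation agents X₀ N (t + 1)
    have hX' : Measurable (jointProcess X₀ N U t) := hX.mono hle le_rfl
    have hU' : Measurable fun ω i => U i t ω := measurable_pi_lambda _ fun i =>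
      (hU t (by omega) hX i).mono hle le_rfl
    have hN : Measurable fun ω i => N i t ω := measurable_pi_lambda _ fun i =>
      measurable_noise X₀ N (Nat.lt_succ_self t) i
    exact (measurable_jointStep.comp (hX'.prodMk hU')).add hN

/-- The joint state is square integrable. As in `measurable_jointProcess`, the inputs may be
feedback laws. -/
theorem memLp_jointProcess [MeasurableSpace Ω] {P : Measure Ω} {X₀ : ∀ i, Ω → (agents i).State}
    {N : ∀ i, ℕ → Ω → (agents i).State} {U : Fin M → ℕ → Ω → Fin m → ℝ} {T : ℕ}
    (hX₀ : ∀ i, MemLp (X₀ i) 2 P) (hN : ∀ i, ∀ t < T, MemLp (N i t) 2 P)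
    (hU : ∀ t < T, MemLp (jointProcess X₀ N U t) 2 P → MemLp (fun ω i => U i t ω) 2 P)
    {t : ℕ} (ht : t ≤ T) : MemLp (jointProcess X₀ N U t) 2 P := by
  induction t with
  | zero => exact MemLp.of_eval hX₀
  | succ t ih =>
    have hX := ih (by omega)
    have hXU : MemLp (fun ω => (jointProcess X₀ N U t ω, fun i => U i t ω)) 2 P :=
      .of_fst_snd ⟨hX, hU t (by omega) hX⟩
    exact (hXU.linearMap_comp (jointStep agents)).add
      (MemLp.of_eval fun i => hN i t (by omega))

end Dynamics

/-! ### The expected cost through Bellman gaps -/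

section DynamicProgramming

variable {M m : ℕ} (agents : Fin M → LQAgent m) {Ω : Type*} [MeasurableSpace Ω] {P : Measure Ω}
  [IsProbabilityMeasure P]

/-- The loss incurred by the input `v` in the state `x` when `n + 1` steps remain: the amount by
which the two sides of the Bellman equation differ. -/
noncomputable def bellmanGap (n : ℕ) : QuadraticForm ℝ (JointState agents × (Fin M → Fin m → ℝ)) :=
  jointStageForm agents + (jointValue agents n).comp (jointStep agents) -
    (jointValue agents (n + 1)).comp (LinearMap.fst ℝ _ _)

theorem bellmanGap_apply (n : ℕ) (x : JointState agents) (v : Fin M → Fin m → ℝ) :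
    bellmanGap agents n (x, v) = jointStageForm agents (x, v) +
      jointValue agents n (jointStep agents (x, v)) - jointValue agents (n + 1) x := by
  simp [bellmanGap]

theorem bellmanGap_nonneg (n : ℕ) (x : JointState agents) {v : Fin M → Fin m → ℝ}
    (hv : ∑ i, v i = 0) : 0 ≤ bellmanGap agents n (x, v) := by
  rw [bellmanGap_apply]
  exact sub_nonneg.2 (jointValue_succ_le agents n x hv)

theorem bellmanGap_feedback (n : ℕ) (x : JointState agents) :
    bellmanGap agents n (x, feedback agents n x) = 0 := by
  rw [bellmanGap_apply, jointValue_succ, sub_self]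

theorem integral_bellmanGap {X W : Ω → JointState agents} {U : Ω → Fin M → Fin m → ℝ} (n : ℕ)
    (hX : MemLp X 2 P) (hU : MemLp U 2 P) (hW : MemLp W 2 P)
    (hind : IndepFun (fun ω => jointStep agents (X ω, U ω)) W P) (hmean : ∫ ω, W ω ∂P = 0) :
    ∫ ω, bellmanGap agents n (X ω, U ω) ∂P =
      ∫ ω, jointStageForm agents (X ω, U ω) ∂P +
        ∫ ω, jointValue agents n (jointStep agents (X ω, U ω) + W ω) ∂P -
        ∫ ω, jointValue agents n (W ω) ∂P - ∫ ω, jointValue agents (n + 1) (X ω) ∂P := by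
  have hXU : MemLp (fun ω => (X ω, U ω)) 2 P := .of_fst_snd ⟨hX, hU⟩
  have hY := hXU.linearMap_comp (jointStep agents)
  have h1 := hXU.integrable_quadraticForm (jointStageForm agents)
  have h2 := hY.integrable_quadraticForm (jointValue agents n)
  have h3 := hX.integrable_quadraticForm (jointValue agents (n + 1))
  simp only [bellmanGap_apply]
  rw [integral_quadraticForm_add _ hY hW hind hmean, integral_sub (h1.fun_add h2) h3,
    integral_add h1 h2]
  ring

variable {T : ℕ} {X₀ : ∀ i, Ω → (agents i).State} {N : ∀ i, ℕ → Ω → (agents i).State}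
  {U : Fin M → ℕ → Ω → Fin m → ℝ}

/-- The expected cost of the optimal control law: the value of the noise-free problem at the
initial state, plus the contribution of each noise to the value of the remaining problem. -/
noncomputable def optimalCost (P : Measure Ω) (T : ℕ) (X₀ : ∀ i, Ω → (agents i).State)
    (N : ∀ i, ℕ → Ω → (agents i).State) : ℝ :=
  ∫ ω, jointValue agents T (fun i => X₀ i ω) ∂P +
    ∑ t ∈ Finset.range T, ∫ ω, jointValue agents (T - (t + 1)) (fun i => N i t ω) ∂P

/-- The expected cost of a square-integrable control law exceeds `optimalCost` by its accumulated
expected Bellman gaps. The expected values of the successive states telescope. -/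
theorem integral_totalCost
    (hX : ∀ t ≤ T, MemLp (jointProcess X₀ N U t) 2 P)
    (hU : ∀ t < T, MemLp (fun ω i => U i t ω) 2 P)
    (hN : ∀ t < T, MemLp (fun ω i => N i t ω : Ω → JointState agents) 2 P)
    (hmean : ∀ t < T, ∫ ω, (fun i => N i t ω : JointState agents) ∂P = 0)
    (hind : ∀ t < T, IndepFun
      (fun ω => jointStep agents (jointProcess X₀ N U t ω, fun i => U i t ω))
      (fun ω i => N i t ω) P) :
    ∫ ω, totalCost agents T X₀ N U ω ∂P = optimalCost agents P T X₀ N +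
      ∑ t ∈ Finset.range T, ∫ ω, bellmanGap agents (T - (t + 1))
        (jointProcess X₀ N U t ω, fun i => U i t ω) ∂P := by
  have hgap : ∀ t ∈ Finset.range T,
      ∫ ω, bellmanGap agents (T - (t + 1)) (jointProcess X₀ N U t ω, fun i => U i t ω) ∂P =
        ∫ ω, jointStageForm agents (jointProcess X₀ N U t ω, fun i => U i t ω) ∂P -
          ∫ ω, jointValue agents (T - (t + 1)) (fun i => N i t ω) ∂P +
        (∫ ω, jointValue agents (T - (t + 1)) (jointProcess X₀ N U (t + 1) ω) ∂P -
          ∫ ω, jointValue agents (T - t) (jointProcess X₀ N U t ω) ∂P) := by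
    intro t ht
    have ht' := Finset.mem_range.1 ht
    rw [integral_bellmanGap agents _ (hX t ht'.le) (hU t ht') (hN t ht') (hind t ht')
      (hmean t ht'), show T - (t + 1) + 1 = T - t by omega]
    simp only [jointProcess_succ]
    ring
  have hsum : ∫ ω, totalCost agents T X₀ N U ω ∂P = ∑ t ∈ Finset.range T,
      ∫ ω, jointStageForm agents (jointProcess X₀ N U t ω, fun i => U i t ω) ∂P := by
    simp only [totalCost_eq]
    refine integral_finsetSum _ fun t ht => ?_
    have ht' := Finset.mem_range.1 ht
    have hXU : MemLp (fun ω => (jointProcess X₀ N U t ω, fun i => U i t ω)) 2 P :=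
      .of_fst_snd ⟨hX t ht'.le, hU t ht'⟩
    exact hXU.integrable_quadraticForm _
  rw [hsum, Finset.sum_congr rfl hgap, Finset.sum_add_distrib, Finset.sum_sub_distrib,
    Finset.sum_range_sub
      fun t => ∫ ω, jointValue agents (T - t) (jointProcess X₀ N U t ω) ∂P, optimalCost]
  simp only [Nat.sub_self, jointValue_zero, integral_zero, Nat.sub_zero]
  change _ = ∫ ω, jointValue agents T (jointProcess X₀ N U 0 ω) ∂P + _ + _
  ring

end DynamicProgramming

/-! ### Gaussian noise and information -/

section Noise

variable {Ω : Type*} [MeasurableSpace Ω] {P : Measure Ω}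

theorem memLp_two_of_hasLaw_gaussian {d : ℕ} {Z : Ω → Fin d → ℝ} {S : Matrix (Fin d) (Fin d) ℝ}
    (h : HasLaw (fun ω => WithLp.toLp 2 (Z ω)) (multivariateGaussian 0 S) P) : MemLp Z 2 P := by
  have h1 : MemLp (fun ω => WithLp.toLp 2 (Z ω)) 2 P := by
    have h2 : MemLp id 2 (P.map fun ω => WithLp.toLp 2 (Z ω)) := by
      rw [h.map_eq]
      exact IsGaussian.memLp_two_id
    exact (memLp_map_measure_iff aestronglyMeasurable_id h.aemeasurable).1 h2
  exact h1.linearMap_comp (EuclideanSpace.equiv (Fin d) ℝ).toLinearEquiv.toLinearMap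

theorem integral_eq_zero_of_hasLaw_gaussian {d : ℕ} {Z : Ω → Fin d → ℝ}
    {S : Matrix (Fin d) (Fin d) ℝ}
    (h : HasLaw (fun ω => WithLp.toLp 2 (Z ω)) (multivariateGaussian 0 S) P) :
    ∫ ω, Z ω ∂P = 0 := by
  have h1 : ∫ ω, WithLp.toLp 2 (Z ω) ∂P = 0 := by
    rw [h.integral_eq, integral_id_multivariateGaussian]
  have h2 := (EuclideanSpace.equiv (Fin d) ℝ).integral_comp_comm (μ := P)
    fun ω => WithLp.toLp 2 (Z ω)
  rw [h1, map_zero] at h2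
  exact h2

variable {M m : ℕ} {agents : Fin M → LQAgent m}

/-- The noise at time `t` has not entered the information available at time `t`. -/
theorem indep_centralInformation_noise {T : ℕ} {X₀ : ∀ i, Ω → (agents i).State}
    {N : ∀ i, ℕ → Ω → (agents i).State} (hX₀ : ∀ i, Measurable (X₀ i))
    (hN : ∀ i, ∀ t < T, Measurable (N i t))
    (hindep : iIndepFun (fun (p : Fin M × Option (Fin T)) (ω : Ω) =>
      p.2.elim (X₀ p.1 ω) (fun t => N p.1 t ω)) P) {t : ℕ} (ht : t < T) :
    Indep (centralInformation agents X₀ N t)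
      (MeasurableSpace.comap (fun ω i => N i t ω : Ω → JointState agents) inferInstance) P := by
  let μ : Fin M × Option (Fin T) → MeasurableSpace Ω := fun p =>
    MeasurableSpace.comap (fun ω => p.2.elim (X₀ p.1 ω) (fun t => N p.1 t ω)) inferInstance
  have hle : ∀ p, μ p ≤ ‹MeasurableSpace Ω› := by
    rintro ⟨i, _ | r⟩
    · exact (hX₀ i).comap_le
    · exact (hN i r r.2).comap_le
  have hdisj : Disjoint {p : Fin M × Option (Fin T) | ∀ r ∈ p.2, r.1 < t}
      {p : Fin M × Option (Fin T) | p.2 = some ⟨t, ht⟩} := by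
    rw [Set.disjoint_left]
    intro p hp hp'
    exact lt_irrefl t (hp ⟨t, ht⟩ hp')
  refine indep_of_indep_of_le_left (indep_of_indep_of_le_right
    (indep_iSup_of_disjoint hle hindep hdisj) ?_) ?_
  · rw [← measurable_iff_comap_le]
    refine @measurable_pi_lambda _ _ _ (⨆ p ∈ _, μ p) _ _ fun i => ?_
    rw [measurable_iff_comap_le]
    exact le_iSup₂_of_le (f := fun p (_ : p ∈ {p : Fin M × Option (Fin T) |
      p.2 = some ⟨t, ht⟩}) => μ p) (i, some ⟨t, ht⟩) rfl le_rfl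
  · refine sup_le (iSup_le fun i => ?_) (iSup_le fun i => iSup_le fun r => iSup_le fun hr => ?_)
    · exact le_iSup₂_of_le (f := fun p (_ : p ∈ {p : Fin M × Option (Fin T) |
        ∀ r ∈ p.2, r.1 < t}) => μ p) (i, none) (fun r hr => by simp at hr) le_rfl
    · exact le_iSup₂_of_le (f := fun p (_ : p ∈ {p : Fin M × Option (Fin T) |
        ∀ r ∈ p.2, r.1 < t}) => μ p) (i, some ⟨r, hr.trans ht⟩)
        (fun r' hr' => by simp at hr'; subst hr'; exact hr) le_rfl

theorem centralInformation_le {T : ℕ} {X₀ : ∀ i, Ω → (agents i).State}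
    {N : ∀ i, ℕ → Ω → (agents i).State} (hX₀ : ∀ i, Measurable (X₀ i))
    (hN : ∀ i, ∀ t < T, Measurable (N i t)) {t : ℕ} (ht : t ≤ T) :
    centralInformation agents X₀ N t ≤ ‹MeasurableSpace Ω› :=
  sup_le (iSup_le fun i => (hX₀ i).comap_le)
    (iSup_le fun i => iSup_le fun r => iSup_le fun hr => (hN i r (hr.trans_le ht)).comap_le)

end Noise

/-! ### Control laws of finite cost -/

section FiniteCost

variable {M m : ℕ} {agents : Fin M → LQAgent m} {Ω : Type*} [MeasurableSpace Ω] {P : Measure Ω}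

/-- Inputs of finite expected cost are square integrable, because `R` is positive definite. -/
theorem memLp_input_of_lintegral_ne_top {T : ℕ} {X₀ : ∀ i, Ω → (agents i).State}
    {N : ∀ i, ℕ → Ω → (agents i).State} {U : Fin M → ℕ → Ω → Fin m → ℝ}
    (hfin : ∫⁻ ω, ENNReal.ofReal (totalCost agents T X₀ N U ω) ∂P ≠ ∞) {t : ℕ} (ht : t < T)
    (i : Fin M) (hU : Measurable (U i t)) : MemLp (U i t) 2 P := by
  refine MemLp.of_eval fun c => ?_
  have hmeas : Measurable fun ω => U i t ω c := (measurable_pi_apply c).comp hU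
  obtain ⟨C, hC, hle⟩ := QuadraticForm.exists_le_mul_of_posDef
    (QuadraticMap.sq.comp (LinearMap.proj c : (Fin m → ℝ) →ₗ[ℝ] ℝ))
    (agents i).R.toQuadraticForm' (agents i).R_posDef.toQuadraticForm'
  have hR : ∀ u, (agents i).R.toQuadraticForm' u = u ⬝ᵥ ((agents i).R *ᵥ u) := fun u => by
    simp [Matrix.toQuadraticForm', LinearMap.BilinMap.toQuadraticMap_apply,
      Matrix.toLinearMap₂'_apply']
  have hcost : ∀ ω, U i t ω c ^ 2 ≤ C * totalCost agents T X₀ N U ω := by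
    intro ω
    have h1 : U i t ω c ^ 2 ≤ C * (U i t ω ⬝ᵥ ((agents i).R *ᵥ U i t ω)) := by
      have := hle (U i t ω)
      rw [hR] at this
      simpa [sq] using this
    refine h1.trans (mul_le_mul_of_nonneg_left ?_ hC.le)
    let f : ℕ → Fin M → ℝ := fun t i => (agents i).stageCost
      ((agents i).closedLoopState (X₀ i) (N i) (U i) t ω) (U i t ω)
    have hf : ∀ t i, 0 ≤ f t i := fun t i => (agents i).stageCost_nonneg _ _
    calc U i t ω ⬝ᵥ ((agents i).R *ᵥ U i t ω) ≤ f t i :=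
          le_add_of_nonneg_left ((agents i).stateCost_nonneg _)
      _ ≤ ∑ i, f t i := Finset.single_le_sum (fun i _ => hf t i) (Finset.mem_univ i)
      _ ≤ ∑ t ∈ Finset.range T, ∑ i, f t i :=
          Finset.single_le_sum (f := fun t => ∑ i, f t i)
            (fun t _ => Finset.sum_nonneg fun i _ => hf t i) (Finset.mem_range.2 ht)
  rw [memLp_two_iff_integrable_sq hmeas.aestronglyMeasurable]
  refine ⟨(hmeas.pow_const 2).aestronglyMeasurable, ?_⟩
  rw [hasFiniteIntegral_iff_ofReal (.of_forall fun ω => sq_nonneg _)]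
  refine (lintegral_mono fun ω => ENNReal.ofReal_le_ofReal (hcost ω)).trans_lt ?_
  simp only [ENNReal.ofReal_mul hC.le]
  rw [lintegral_const_mul' _ _ ENNReal.ofReal_ne_top]
  exact ENNReal.mul_lt_top ENNReal.ofReal_lt_top hfin.lt_top

end FiniteCost

/-! ### Runs of the bid-price scheme -/

section Scheme

variable {M m : ℕ} {agents : Fin M → LQAgent m} {T : ℕ} {Ω : Type*}
  {X₀ : ∀ i, Ω → (agents i).State} {N : ∀ i, ℕ → Ω → (agents i).State} {α : ℕ → ℝ}

theorem IsBidPriceScheme.exists_limits {price : ℕ → ℕ → Ω → ℕ → Fin m → ℝ}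
    {bid : ℕ → ℕ → Fin M → Ω → ℕ → Fin m → ℝ} {U : Fin M → ℕ → Ω → Fin m → ℝ}
    (h : IsBidPriceScheme agents T α X₀ N price bid U) (hαpos : ∀ k, 0 < α k)
    (hα0 : Tendsto α atTop (𝓝 0))
    (hαsum : Tendsto (fun n => ∑ k ∈ Finset.range n, α k) atTop atTop) {s : ℕ} (hs : s < T)
    (ω : Ω) : ∃ (priceLim : ℕ → Fin m → ℝ) (bidLim : Fin M → ℕ → Fin m → ℝ),
      (∀ t, s ≤ t → t < T →
        Tendsto (fun k => price s k ω t) atTop (𝓝 (priceLim t)) ∧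
        (∀ i, Tendsto (fun k => bid s k i ω t) atTop (𝓝 (bidLim i t))) ∧
        ∑ i, bidLim i t = 0) ∧
      ∀ i, bidLim i s = feedback agents (T - (s + 1)) (jointProcess X₀ N U s ω) i := by
  obtain ⟨n, rfl⟩ := Nat.exists_eq_add_of_lt hs
  obtain ⟨⟨l, hl⟩, hbid⟩ :=
    (h.iteration s hs ω).tendsto_balancedPlan agents (n := n + 1) hαpos hα0 hαsum
  refine ⟨LQAgent.extendPlan s (n + 1) l, fun i => LQAgent.extendPlan s (n + 1)
    (balancedPlan agents (n + 1) (jointProcess X₀ N U s ω) i), fun t hst ht => ?_, fun i => ?_⟩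
  · obtain ⟨j, rfl⟩ := Nat.exists_eq_add_of_le hst
    have hj : j < n + 1 := by omega
    have hext : ∀ v : Fin (n + 1) → Fin m → ℝ,
        LQAgent.extendPlan s (n + 1) v (s + j) = v ⟨j, hj⟩ := fun v =>
      congrFun (LQAgent.window_extendPlan s (n + 1) v) ⟨j, hj⟩
    simp only [hext]
    refine ⟨tendsto_pi_nhds.1 hl ⟨j, hj⟩, fun i => tendsto_pi_nhds.1 (hbid i) ⟨j, hj⟩, ?_⟩
    have := congrFun (sum_balancedPlan agents (n + 1) (jointProcess X₀ N U s ω)) ⟨j, hj⟩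
    rwa [Finset.sum_apply] at this
  · rw [show s + n + 1 - (s + 1) = n by omega, feedback_apply]
    exact congrFun (LQAgent.window_extendPlan s (n + 1) _) 0

/-- Every run of the scheme implements the certainty-equivalent feedback law. -/
theorem IsBidPriceScheme.eq_feedback {price : ℕ → ℕ → Ω → ℕ → Fin m → ℝ}
    {bid : ℕ → ℕ → Fin M → Ω → ℕ → Fin m → ℝ} {U : Fin M → ℕ → Ω → Fin m → ℝ}
    (h : IsBidPriceScheme agents T α X₀ N price bid U) (hαpos : ∀ k, 0 < α k)
    (hα0 : Tendsto α atTop (𝓝 0))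
    (hαsum : Tendsto (fun n => ∑ k ∈ Finset.range n, α k) atTop atTop) {s : ℕ} (hs : s < T)
    (ω : Ω) :
    (fun i => U i s ω) = feedback agents (T - (s + 1)) (jointProcess X₀ N U s ω) := by
  obtain ⟨_, bidLim, hlim, hfeed⟩ := h.exists_limits hαpos hα0 hαsum hs ω
  ext i : 1
  rw [← hfeed i]
  exact h.implement s hs ω i _ ((hlim s le_rfl hs).2.1 i)

/-- The closed loop under the feedback law, built by recursion over time. -/
theorem exists_feedback_control (T : ℕ) (X₀ : ∀ i, Ω → (agents i).State)
    (N : ∀ i, ℕ → Ω → (agents i).State) : ∃ U : Fin M → ℕ → Ω → Fin m → ℝ,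
      ∀ s ω, (fun i => U i s ω) = feedback agents (T - (s + 1)) (jointProcess X₀ N U s ω) := by
  let X : ℕ → Ω → JointState agents := fun t =>
    Nat.rec (fun ω i => X₀ i ω) (fun t X ω =>
      jointStep agents (X ω, feedback agents (T - (t + 1)) (X ω)) + fun i => N i t ω) t
  let U : Fin M → ℕ → Ω → Fin m → ℝ := fun i t ω => feedback agents (T - (t + 1)) (X t ω) i
  have hX : ∀ t ω, jointProcess X₀ N U t ω = X t ω := by
    intro t ω
    induction t with
    | zero => rfl
    | succ t ih => rw [jointProcess_succ, ih]
  exact ⟨U, fun s ω => by rw [hX]⟩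

theorem exists_isBidPriceScheme (hαpos : ∀ k, 0 < α k)
    (hα0 : Tendsto α atTop (𝓝 0))
    (hαsum : Tendsto (fun n => ∑ k ∈ Finset.range n, α k) atTop atTop)
    (X₀ : ∀ i, Ω → (agents i).State) (N : ∀ i, ℕ → Ω → (agents i).State)
    (price₀ : ℕ → Ω → ℕ → Fin m → ℝ) : ∃ price bid U,
      IsBidPriceScheme agents T α X₀ N price bid U ∧ ∀ s ω, price s 0 ω = price₀ s ω := by
  obtain ⟨U, hU⟩ := exists_feedback_control (agents := agents) T X₀ N
  have hex : ∀ s ω, ∃ price bid,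
      (s < T → IsBidPriceIteration agents T α s (jointProcess X₀ N U s ω) price bid) ∧
        price 0 = price₀ s ω := by
    intro s ω
    obtain ⟨price, bid, h, h0⟩ := exists_isBidPriceIteration agents s (T - s) α
      (jointProcess X₀ N U s ω) (price₀ s ω)
    refine ⟨price, bid, fun hs => ?_, h0⟩
    rwa [Nat.add_sub_cancel' hs.le] at h
  choose price bid hiter h0 using hex
  refine ⟨fun s k ω => price s ω k, fun s k i ω => bid s ω k i, U,
    ⟨fun s hs ω => hiter s ω hs, fun s hs ω i l hl => ?_⟩, h0⟩
  obtain ⟨n, rfl⟩ := Nat.exists_eq_add_of_lt hs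
  have hlim := tendsto_pi_nhds.1 (((hiter s ω hs).tendsto_balancedPlan agents (n := n + 1)
    hαpos hα0 hαsum).2 i) 0
  have := congrFun (hU s ω) i
  rw [show s + n + 1 - (s + 1) = n by omega, feedback_apply] at this
  exact this.trans (tendsto_nhds_unique hlim hl)

end Scheme

/-! ### Optimality of the feedback law -/

section Optimality

variable {M m : ℕ} {agents : Fin M → LQAgent m} {T : ℕ}
  {Ω : Type*} [MeasurableSpace Ω] {P : Measure Ω} [IsProbabilityMeasure P]
  {X₀ : ∀ i, Ω → (agents i).State} {N : ∀ i, ℕ → Ω → (agents i).State}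
  {U : Fin M → ℕ → Ω → Fin m → ℝ}

/-- What the optimality argument uses about the initial states and noises: they are measurable
and square integrable, and each noise is centred and independent of the information available at its time. -/
structure IsSquareIntegrableNoise (P : Measure Ω) (T : ℕ) (X₀ : ∀ i, Ω → (agents i).State)
    (N : ∀ i, ℕ → Ω → (agents i).State) : Prop where
  measurable_init : ∀ i, Measurable (X₀ i)
  measurable_noise : ∀ i, ∀ t < T, Measurable (N i t)
  memLp_init : ∀ i, MemLp (X₀ i) 2 P
  memLp_noise : ∀ i, ∀ t < T, MemLp (N i t) 2 P
  integral_noise : ∀ i, ∀ t < T, ∫ ω, N i t ω ∂P = 0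
  indep : ∀ t < T, Indep (centralInformation agents X₀ N t)
    (MeasurableSpace.comap (fun ω i => N i t ω : Ω → JointState agents) inferInstance) P

theorem IsSquareIntegrableNoise.integral_totalCost (h : IsSquareIntegrableNoise P T X₀ N)
    (hUmeas : ∀ t < T, ∀ i, Measurable[centralInformation agents X₀ N t] (U i t))
    (hX : ∀ t ≤ T, MemLp (jointProcess X₀ N U t) 2 P)
    (hU : ∀ t < T, MemLp (fun ω i => U i t ω) 2 P) :
    Integrable (totalCost agents T X₀ N U) P ∧
    ∫ ω, totalCost agents T X₀ N U ω ∂P = optimalCost agents P T X₀ N +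
      ∑ t ∈ Finset.range T, ∫ ω, bellmanGap agents (T - (t + 1))
        (jointProcess X₀ N U t ω, fun i => U i t ω) ∂P := by
  constructor
  · have : totalCost agents T X₀ N U = fun ω => ∑ t ∈ Finset.range T,
        jointStageForm agents (jointProcess X₀ N U t ω, fun i => U i t ω) :=
      funext (totalCost_eq T X₀ N U)
    rw [this]
    refine integrable_finsetSum _ fun t ht => ?_
    have ht' := Finset.mem_range.1 ht
    have hXU : MemLp (fun ω => (jointProcess X₀ N U t ω, fun i => U i t ω)) 2 P :=
      .of_fst_snd ⟨hX t ht'.le, hU t ht'⟩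
    exact hXU.integrable_quadraticForm _
  refine _root_.integral_totalCost agents hX hU
    (fun t ht => MemLp.of_eval fun i => h.memLp_noise i t ht) (fun t ht => ?_) fun t ht => ?_
  · ext i : 1
    rw [eval_integral fun i => (h.memLp_noise i t ht).integrable one_le_two]
    exact h.integral_noise i t ht
  · rw [IndepFun_iff_Indep]
    refine indep_of_indep_of_le_left (h.indep t ht) ?_
    rw [← measurable_iff_comap_le]
    have hXt := measurable_jointProcess (U := U) (fun t ht _ => hUmeas t ht) ht.le
    have hUt : Measurable[centralInformation agents X₀ N t] fun ω i => U i t ω :=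
      @measurable_pi_lambda _ _ _ (centralInformation agents X₀ N t) _ _ (hUmeas t ht)
    exact measurable_jointStep.comp (hXt.prodMk hUt)

/-- No centralized control law has an expected cost below `optimalCost`. -/
theorem IsSquareIntegrableNoise.optimalCost_le (h : IsSquareIntegrableNoise P T X₀ N)
    (hU : U ∈ centralizedPolicies agents T P X₀ N) :
    ENNReal.ofReal (optimalCost agents P T X₀ N) ≤
      ∫⁻ ω, ENNReal.ofReal (totalCost agents T X₀ N U ω) ∂P := by
  by_cases hfin : ∫⁻ ω, ENNReal.ofReal (totalCost agents T X₀ N U ω) ∂P = ∞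
  -- an infinite expected cost satisfies the bound trivially
  · rw [hfin]; exact le_top
  have hUL : ∀ t < T, MemLp (fun ω i => U i t ω) 2 P := fun t ht => MemLp.of_eval fun i =>
    memLp_input_of_lintegral_ne_top hfin ht i (((hU t ht).1 i).mono
      (centralInformation_le h.measurable_init h.measurable_noise ht.le) le_rfl)
  have hX : ∀ t ≤ T, MemLp (jointProcess X₀ N U t) 2 P := fun t ht =>
    memLp_jointProcess h.memLp_init h.memLp_noise (fun t ht _ => hUL t ht) ht
  obtain ⟨hint, heq⟩ := h.integral_totalCost (fun t ht => (hU t ht).1) hX hUL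
  rw [← ofReal_integral_eq_lintegral_ofReal hint (.of_forall (totalCost_nonneg T X₀ N U)), heq]
  refine ENNReal.ofReal_le_ofReal (le_add_of_nonneg_right (Finset.sum_nonneg fun t ht => ?_))
  refine integral_nonneg_of_ae ?_
  filter_upwards [(hU t (Finset.mem_range.1 ht)).2] with ω hω
  exact bellmanGap_nonneg agents _ _ hω

/-- The feedback law is a centralized control law whose expected cost is `optimalCost`. -/
theorem IsSquareIntegrableNoise.feedback_optimal (h : IsSquareIntegrableNoise P T X₀ N)
    (hU : ∀ t < T, ∀ ω,
      (fun i => U i t ω) = feedback agents (T - (t + 1)) (jointProcess X₀ N U t ω)) :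
    U ∈ centralizedPolicies agents T P X₀ N ∧ Integrable (totalCost agents T X₀ N U) P ∧
      ∫⁻ ω, ENNReal.ofReal (totalCost agents T X₀ N U ω) ∂P =
        ENNReal.ofReal (optimalCost agents P T X₀ N) := by
  have hUstep : ∀ t < T, Measurable[centralInformation agents X₀ N t] (jointProcess X₀ N U t) →
      ∀ i, Measurable[centralInformation agents X₀ N t] (U i t) := by
    intro t ht hXt i
    have : U i t = fun ω => feedback agents (T - (t + 1)) (jointProcess X₀ N U t ω) i :=
      funext fun ω => congrFun (hU t ht ω) i
    rw [this]
    exact ((measurable_pi_apply i).comp (LinearMap.continuous_of_finiteDimensional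
      (feedback agents (T - (t + 1)))).measurable).comp hXt
  have hUmeas : ∀ t < T, ∀ i, Measurable[centralInformation agents X₀ N t] (U i t) :=
    fun t ht => hUstep t ht (measurable_jointProcess hUstep ht.le)
  have hULstep : ∀ t < T, MemLp (jointProcess X₀ N U t) 2 P →
      MemLp (fun ω i => U i t ω) 2 P := fun t ht hXt => by
    rw [funext (hU t ht)]
    exact hXt.linearMap_comp _
  have hX : ∀ t ≤ T, MemLp (jointProcess X₀ N U t) 2 P := fun t ht =>
    memLp_jointProcess h.memLp_init h.memLp_noise hULstep ht
  obtain ⟨hint, heq⟩ := h.integral_totalCost hUmeas hX fun t ht => hULstep t ht (hX t ht.le)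
  refine ⟨fun t ht => ⟨hUmeas t ht, .of_forall fun ω => ?_⟩, hint, ?_⟩
  · have := sum_feedback agents (T - (t + 1)) (jointProcess X₀ N U t ω)
    rwa [← hU t ht ω] at this
  · rw [← ofReal_integral_eq_lintegral_ofReal hint (.of_forall (totalCost_nonneg T X₀ N U)), heq,
      Finset.sum_eq_zero, add_zero]
    intro t ht
    simp only [hU t (Finset.mem_range.1 ht), bellmanGap_feedback, integral_zero]

end Optimality

theorem theorem5 {M m : ℕ} (agents : Fin M → LQAgent m) (T : ℕ)
    {Ω : Type*} [MeasurableSpace Ω] (P : Measure Ω) [IsProbabilityMeasure P]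
    -- Gaussian initial states and noises, all independent
    (X₀ : ∀ i, Ω → (agents i).State) (N : ∀ i, ℕ → Ω → (agents i).State)
    (initCov : ∀ i, Matrix (Fin (agents i).dim) (Fin (agents i).dim) ℝ)
    (noiseCov : ∀ i, ℕ → Matrix (Fin (agents i).dim) (Fin (agents i).dim) ℝ)
    (hX₀ : ∀ i, Measurable (X₀ i)) (hN : ∀ i, ∀ t < T, Measurable (N i t))
    (hinitCov : ∀ i, (initCov i).PosSemidef)
    (hnoiseCov : ∀ i, ∀ t < T, (noiseCov i t).PosSemidef)
    (hX₀law : ∀ i, HasLaw (fun ω => WithLp.toLp 2 (X₀ i ω))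
      (multivariateGaussian 0 (initCov i)) P)
    (hNlaw : ∀ i, ∀ t < T, HasLaw (fun ω => WithLp.toLp 2 (N i t ω))
      (multivariateGaussian 0 (noiseCov i t)) P)
    (hindep : iIndepFun (fun (p : Fin M × Option (Fin T)) (ω : Ω) =>
      p.2.elim (X₀ p.1 ω) (fun t => N p.1 t ω)) P)
    -- the step sizes
    (α : ℕ → ℝ) (hαpos : ∀ k, 0 < α k) (hα0 : Tendsto α atTop (𝓝 0))
    (hαsum : Tendsto (fun n => ∑ k ∈ Finset.range n, α k) atTop atTop) :
    -- the scheme can be run from arbitrary initial prices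
    (∀ price₀ : ℕ → Ω → ℕ → Fin m → ℝ, ∃ price bid U,
      IsBidPriceScheme agents T α X₀ N price bid U ∧
        ∀ s < T, ∀ ω t, s ≤ t → t < T → price s 0 ω t = price₀ s ω t) ∧
    ∀ price bid U, IsBidPriceScheme agents T α X₀ N price bid U →
      -- at each time the prices and the bids converge, the limiting bids are balanced, and
      -- their first entries are implemented
      (∀ s < T, ∀ ω, ∃ (priceLim : ℕ → Fin m → ℝ) (bidLim : Fin M → ℕ → Fin m → ℝ),
        (∀ t, s ≤ t → t < T →
          Tendsto (fun k => price s k ω t) atTop (𝓝 (priceLim t)) ∧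
          (∀ i, Tendsto (fun k => bid s k i ω t) atTop (𝓝 (bidLim i t))) ∧
          ∑ i, bidLim i t = 0) ∧
        ∀ i, U i s ω = bidLim i s) ∧
      -- the expected cost is finite, and the maximal social welfare over all centralized
      -- control laws is attained
      Integrable (totalCost agents T X₀ N U) P ∧
      U ∈ centralizedPolicies agents T P X₀ N ∧
      IsGreatest (socialWelfare agents T P X₀ N '' centralizedPolicies agents T P X₀ N)
        (socialWelfare agents T P X₀ N U) := by
  have hnoise : IsSquareIntegrableNoise P T X₀ N :=
    { measurable_init := hX₀
      measurable_noise := hN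
      memLp_init := fun i => memLp_two_of_hasLaw_gaussian (hX₀law i)
      memLp_noise := fun i t ht => memLp_two_of_hasLaw_gaussian (hNlaw i t ht)
      integral_noise := fun i t ht => integral_eq_zero_of_hasLaw_gaussian (hNlaw i t ht)
      indep := fun t ht => indep_centralInformation_noise hX₀ hN hindep ht }
  refine ⟨fun price₀ => ?_, fun price bid U h => ?_⟩
  · obtain ⟨price, bid, U, h, h0⟩ :=
      exists_isBidPriceScheme (T := T) hαpos hα0 hαsum X₀ N price₀
    exact ⟨price, bid, U, h, fun s _ ω t _ _ => by rw [h0]⟩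
  have hfeed := fun s (hs : s < T) ω => h.eq_feedback hαpos hα0 hαsum hs ω
  obtain ⟨hmem, hint, hcost⟩ := hnoise.feedback_optimal hfeed
  refine ⟨fun s hs ω => ?_, hint, hmem, Set.mem_image_of_mem _ hmem, ?_⟩
  · obtain ⟨priceLim, bidLim, hlim, hbid⟩ := h.exists_limits hαpos hα0 hαsum hs ω
    exact ⟨priceLim, bidLim, hlim, fun i => (congrFun (hfeed s hs ω) i).trans (hbid i).symm⟩
  · rintro _ ⟨V, hV, rfl⟩
    rw [socialWelfare, socialWelfare, EReal.neg_le_neg_iff, hcost]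
    exact EReal.coe_ennreal_le_coe_ennreal_iff.2 (hnoise.optimalCost_le hV)
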